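/- Let $\mathcal H$ be a separable complex Hilbert space and $\mathcal N$ a continuous nest of orthogonal projections on $\mathcal H$ (a chain of projections containing $0$ and $I$, closed under arbitrary suprema and infima, in which every $N$ is the supremum of $\{M\in\mathcal N : M<N\}$). Let $\operatorname{Alg}\mathcal N=\{X\in B(\mathcal H) : XN=NXN \text{ for all } N\in\mathcal N\}$, and let $\|\cdot\|_e$ be the essential norm (distance to the compact operators). An interval of $\mathcal N$ is a projection $N-M$ with $M\le N$ in $\mathcal N$. For families of intervals, $P_1$ refines $P_2$ if every $E\in P_1$ satisfies $E\le F$ for some $F\in P_2$. A net of intervals is a non-empty set $\mathcal O$ of families of intervals that is directed under refinement; it is stable if $\theta(P)=\{\theta(N)-\theta(M) : M\le N \text{ in }\mathcal N,\ N-M\in P\}$ belongs to $\mathcal O$ for every $P\in\mathcal O$ and every order isomorphism $\theta$ of $\mathcal N$ onto itself. The ideal associated with $\mathcal O$ is $$\mathcal I=\Bigl\{X\in\operatorname{Alg}\mathcal N : \lim_{P\in\mathcal O}\ \sup_{E\in P}\|EXE\|_e=0\Bigr\}.$$ Say that $\mathcal O_1$ is cofinal in $\mathcal O_2$ if every $Q\in\mathcal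 O_2$ is refined by some $P\in\mathcal O_1$. **Theorem.** (1) Let $\mathcal O_1$ and $\mathcal O_2$ be stable nets of intervals of $\mathcal N$ with associated ideals $\mathcal I_1$ and $\mathcal I_2$, and suppose that every family in $\mathcal O_2$ is non-empty. Then $\mathcal I_1\supseteq\mathcal I_2$ if and only if $\mathcal O_1$ is cofinal in $\mathcal O_2$. (2) Stability cannot be omitted. If $\mathcal H\neq 0$, then $\mathcal N\setminus\{0,I\}$ has a strongly continuous, strictly increasing parametrization $t\mapsto N_t$ by $t\in\mathbb R$. For every such parametrization put $P_S=\{N_{s+1}-N_s : s\in S\}$ for $S\subseteq\mathbb R$, let $\mathcal O_1$ be the set of all $P_S$ with $S\subseteq\mathbb Q$ and $\mathbb Q\setminus S$ a $G_\delta$ subset of $\mathbb R$, and let $\mathcal O_2=\{P_{\mathbb R\setminus\mathbb Q}\}$. Then $\mathcal O_1$ and $\mathcal O_2$ are nets of intervals, neither of which is stable, their associated ideals satisfy $\mathcal I_1\supseteq\mathcal I_2$, and yet $\mathcal O_1$ is not cofinal in $\mathcal O_2$ (nor is $\mathcal O_2$ cofinal in $\mathcal O_1$). -/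

import Mathlib

open scoped Topology

noncomputable section

namespace NestAlgebra

variable {H : Type*} [NormedAddCommGroup H] [InnerProductSpace ℂ H] [CompleteSpace H]

/-- A continuous nest of (orthogonal) projections on the Hilbert space `H`: a chain of projections
containing `0` and `1`, closed under arbitrary suprema (closed spans of ranges) and infima
(intersections of ranges), and such that every `N` in it is the supremum of its strict
predecessors (that is, the nest has no atoms). Operators carry the Loewner order, which on
projections is inclusion of ranges. -/
structure IsContinuousNest (𝒩 : Set (H →L[ℂ] H)) : Prop where
  isStarProjection : ∀ N ∈ 𝒩, IsStarProjection N
  chain : ∀ M ∈ 𝒩, ∀ N ∈ 𝒩, M ≤ N ∨ N ≤ M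
  zero_mem : 0 ∈ 𝒩
  one_mem : 1 ∈ 𝒩
  sup_mem : ∀ S : Set (H →L[ℂ] H), S ⊆ 𝒩 →
    ∃ N ∈ 𝒩, LinearMap.range N.toLinearMap =
      (⨆ M ∈ S, LinearMap.range M.toLinearMap).topologicalClosure
  inf_mem : ∀ S : Set (H →L[ℂ] H), S ⊆ 𝒩 →
    ∃ N ∈ 𝒩, LinearMap.range N.toLinearMap = ⨅ M ∈ S, LinearMap.range M.toLinearMap
  continuous : ∀ N ∈ 𝒩, LinearMap.range N.toLinearMap =
    (⨆ M ∈ {M | M ∈ 𝒩 ∧ M < N}, LinearMap.range M.toLinearMap).topologicalClosure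

/-- The nest algebra `Alg 𝒩`: the bounded operators leaving the range of each `N ∈ 𝒩` invariant. -/
def nestAlg (𝒩 : Set (H →L[ℂ] H)) : Set (H →L[ℂ] H) :=
  {X | ∀ N ∈ 𝒩, X * N = N * X * N}

/-- The intervals of `𝒩`: the projections `N - M` with `M ≤ N` in `𝒩` (`0` is allowed). -/
def IsInterval (𝒩 : Set (H →L[ℂ] H)) (E : H →L[ℂ] H) : Prop :=
  ∃ M ∈ 𝒩, ∃ N ∈ 𝒩, M ≤ N ∧ E = N - M

/-- `P₁` refines `P₂`: each member of `P₁` is below some member of `P₂`. -/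
def Refines (P₁ P₂ : Set (H →L[ℂ] H)) : Prop :=
  ∀ E ∈ P₁, ∃ F ∈ P₂, E ≤ F

/-- A net of intervals of `𝒩`: a (non-empty) set of families of intervals that is directed under
refinement. -/
structure IsNet (𝒩 : Set (H →L[ℂ] H)) (O : Set (Set (H →L[ℂ] H))) : Prop where
  nonempty : O.Nonempty
  isInterval : ∀ P ∈ O, ∀ E ∈ P, IsInterval 𝒩 E
  directed : ∀ P₁ ∈ O, ∀ P₂ ∈ O, ∃ P ∈ O, Refines P P₁ ∧ Refines P P₂

/-- The image `θ(P)` of a family of intervals under an order isomorphism `θ` of `𝒩`, where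
`θ(N - M) = θ(N) - θ(M)`. -/
def imageFamily {𝒩 : Set (H →L[ℂ] H)} (θ : 𝒩 ≃o 𝒩) (P : Set (H →L[ℂ] H)) :
    Set (H →L[ℂ] H) :=
  {E | ∃ M N : 𝒩, M ≤ N ∧ (N : H →L[ℂ] H) - (M : H →L[ℂ] H) ∈ P ∧
    E = (θ N : H →L[ℂ] H) - (θ M : H →L[ℂ] H)}

/-- Invariance of a set of families under all order isomorphisms of `𝒩` onto itself. -/
def IsStable (𝒩 : Set (H →L[ℂ] H)) (O : Set (Set (H →L[ℂ] H))) : Prop :=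
  ∀ θ : 𝒩 ≃o 𝒩, ∀ P ∈ O, imageFamily θ P ∈ O

/-- The essential norm: the distance to the compact operators. -/
def essNorm (X : H →L[ℂ] H) : ℝ :=
  Metric.infDist X {K : H →L[ℂ] H | IsCompactOperator K}

/-- `sup_{E ∈ P} ‖E X E‖ₑ`. For a family of projections this is a supremum of a set of reals bounded
by `‖X‖`; it is `0` for the empty family. -/
def supEssNorm (P : Set (H →L[ℂ] H)) (X : H →L[ℂ] H) : ℝ :=
  sSup ((fun E : H →L[ℂ] H => essNorm (E * X * E)) '' P)

/-- The ideal associated with the net `O`: those `X ∈ Alg 𝒩` for which the net of reals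
`sup_{E ∈ P} ‖E X E‖ₑ` (`P ∈ O`, ordered by refinement) converges to `0`. -/
def netIdeal (𝒩 : Set (H →L[ℂ] H)) (O : Set (Set (H →L[ℂ] H))) : Set (H →L[ℂ] H) :=
  {X | X ∈ nestAlg 𝒩 ∧
    ∀ ε : ℝ, 0 < ε → ∃ P₀ ∈ O, ∀ P ∈ O, Refines P P₀ → |supEssNorm P X| < ε}

/-- `O₁` is cofinal in `O₂`: every family in `O₂` is refined by some family in `O₁`. -/
def IsCofinalIn (O₁ O₂ : Set (Set (H →L[ℂ] H))) : Prop :=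
  ∀ Q ∈ O₂, ∃ P ∈ O₁, Refines P Q

/-- `t ↦ N t` is a strongly continuous, strictly increasing parametrization of `𝒩 \ {0, 1}` by the
real line. -/
structure IsRealParametrization (𝒩 : Set (H →L[ℂ] H)) (N : ℝ → (H →L[ℂ] H)) : Prop where
  continuous : ∀ x : H, Continuous fun t => N t x
  strictMono : StrictMono N
  range_eq : Set.range N = 𝒩 \ {0, 1}

/-- The family `{N (s + 1) - N s : s ∈ S}`. -/
def unitFamily (N : ℝ → (H →L[ℂ] H)) (S : Set ℝ) : Set (H →L[ℂ] H) :=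
  (fun s : ℝ => N (s + 1) - N s) '' S

/-- The set of all `unitFamily N S` with `S ⊆ ℚ` and `ℚ \ S` a Gδ subset of `ℝ`. -/
def rationalNet (N : ℝ → (H →L[ℂ] H)) : Set (Set (H →L[ℂ] H)) :=
  {P | ∃ S : Set ℝ, S ⊆ Set.range ((↑) : ℚ → ℝ) ∧ IsGδ (Set.range ((↑) : ℚ → ℝ) \ S) ∧
    P = unitFamily N S}

/-- The singleton consisting of `unitFamily N (ℝ \ ℚ)`. -/
def irrationalNet (N : ℝ → (H →L[ℂ] H)) : Set (Set (H →L[ℂ] H)) :=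
  {unitFamily N {s : ℝ | Irrational s}}

end NestAlgebra

end

/-!
One implication of the characterization is monotonicity: if `P` refines `Q`, then the supremum of the
essential norms over `P` is at most that over `Q`.

For the converse identify the nest with `[0, 1]` and fix a family `Q` in the net `O₂`. It has to be
shown that some family in `O₁` contains only intervals lying below members of `Q`; call the
other intervals *bad*. An operator detects a set `M` of bad intervals if its compressions to the
members of `M` have essential norm at least `1`, while it belongs to the ideal of `O₂`. If that ideal
is contained in the ideal of `O₁`, then all fine enough families in `O₁` avoid `M`
(`IsDetected.avoids`). By directedness it suffices to detect each of finitely many sets that cover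
the bad intervals.

A detecting operator is a sum of rank-one operators, which map a unit vector of an interval
`[γ, δ]` to a unit vector of an interval `[α, β]` on its left, for countably many pairs of intervals;
the sum belongs to the nest algebra, and whether its compressions are compact is read off from the
position of the pairs (`exists_partialIsometry`, `isCompactOperator_compression`,
`one_le_essNorm`). The compressions to the members of `Q` alone need not be compact, and this is
where stability enters: `O₂` contains a common refinement of `Q` and its image under an automorphism
`θ` of the nest, so that only compressions to intervals that lie below members of both families
matter.

What remains is a statement about intervals of the real line (`IsDownset.isDetectable_compl`). A bad
interval may contain in its interior a point that is interior to no member of `Q`; pairs converging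
from both sides to the points of a countable dense set of such points detect these intervals. The
others lie in the closure of a component `(u, v)` of the set of points which are interior to a member
of `Q`. Up to reflection they are the whole of `[u, v]`, intervals ending in `v`, and intervals
inside `(u, v)`. The latter are the principal case: with `g x` the supremum of the right ends of good
intervals starting at `x`, a sequence `X₁ < X₂ < …` with `X (k + 1)` slightly smaller than `g (X k)`
has the properties that each bad interval in the right half of `(u, v)` contains a gap between
`X (k + 2)` and `g (X (k + 1))`, and that the interval from `X (k + 1)` to `X (k + 3)` is bad. The
automorphism `θ` squeezes the latter interval into the gap, and then no interval below the image of
`Q` contains the gap. Four automorphisms, one for each residue class of `k` modulo `4`, deal with all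
`k` and all components simultaneously.

For the nets indexed by rational and by irrational numbers, `s ↦ ‖E_s X E_s‖ₑ` vanishes at irrational
`s` if `X` is in the ideal of the latter net. Hence the set where it is at least `ε` consists of
rational numbers, and it is a `Gδ` set since the essential norm is a countable infimum of lower
semicontinuous functions of `s` (`isGδ_le_essNorm`); this is exactly what membership in the ideal of
the former net requires. Cofinality fails since distinct intervals of unit length are never
comparable and `ℚ` is not a `Gδ` set. Stability fails since translation by `√2` maps a rational
number to an irrational one, and an irrational number to a rational one.
-/

noncomputable section

namespace NestAlgebra

open Set

set_option linter.unusedSectionVars false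

/-! ### Order automorphisms of the real line -/

open Classical in
/-- The function equal to `θ i` on the open interval `(l i, r i)` and to the identity elsewhere. -/
def glueFun {ι : Type*} (l r : ι → ℝ) (θ : ι → ℝ → ℝ) (x : ℝ) : ℝ :=
  if h : ∃ i, x ∈ Ioo (l i) (r i) then θ h.choose x else x

theorem glueFun_of_mem {ι : Type*} {l r : ι → ℝ} {θ : ι → ℝ → ℝ}
    (hd : ∀ i j x, x ∈ Ioo (l i) (r i) → x ∈ Ioo (l j) (r j) → i = j) {i : ι} {x : ℝ}
    (hx : x ∈ Ioo (l i) (r i)) : glueFun l r θ x = θ i x := by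
  have h : ∃ i, x ∈ Ioo (l i) (r i) := ⟨i, hx⟩
  rw [glueFun, dif_pos h, hd _ _ x h.choose_spec hx]

theorem glueFun_of_notMem {ι : Type*} {l r : ι → ℝ} {θ : ι → ℝ → ℝ} {x : ℝ}
    (hx : ∀ i, x ∉ Ioo (l i) (r i)) : glueFun l r θ x = x := by
  rw [glueFun, dif_neg (by simpa using hx)]

theorem glueFun_glueFun {ι : Type*} {l r : ι → ℝ} {θ θ' : ι → ℝ → ℝ}
    (hd : ∀ i j x, x ∈ Ioo (l i) (r i) → x ∈ Ioo (l j) (r j) → i = j)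
    (hθ : ∀ i x, x ∈ Ioo (l i) (r i) → θ i x ∈ Ioo (l i) (r i))
    (hinv : ∀ i x, θ' i (θ i x) = x) (x : ℝ) :
    glueFun l r θ' (glueFun l r θ x) = x := by
  by_cases h : ∃ i, x ∈ Ioo (l i) (r i)
  · obtain ⟨i, hi⟩ := h
    rw [glueFun_of_mem hd hi, glueFun_of_mem hd (hθ i x hi), hinv]
  · push Not at h
    rw [glueFun_of_notMem h, glueFun_of_notMem h]

/-- Order automorphisms prescribed on disjoint open intervals, whose endpoints they fix, glue to an
order automorphism that is the identity off these intervals. -/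
theorem exists_orderIso_glue {ι : Type*} (l r : ι → ℝ)
    (hd : ∀ i j x, x ∈ Ioo (l i) (r i) → x ∈ Ioo (l j) (r j) → i = j) (θ : ι → ℝ ≃o ℝ)
    (hl : ∀ i, θ i (l i) = l i) (hr : ∀ i, θ i (r i) = r i) :
    ∃ Θ : ℝ ≃o ℝ, (∀ i, ∀ x ∈ Ioo (l i) (r i), Θ x = θ i x) ∧
      ∀ x, (∀ i, x ∉ Ioo (l i) (r i)) → Θ x = x := by
  have hmem : ∀ i x, x ∈ Ioo (l i) (r i) → θ i x ∈ Ioo (l i) (r i) := fun i x hx =>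
    ⟨by rw [← hl i]; exact (θ i).strictMono hx.1, by rw [← hr i]; exact (θ i).strictMono hx.2⟩
  have hmem' : ∀ i x, x ∈ Ioo (l i) (r i) → (θ i).symm x ∈ Ioo (l i) (r i) := fun i x hx =>
    ⟨by rw [(θ i).lt_symm_apply, hl i]; exact hx.1, by rw [(θ i).symm_apply_lt, hr i]; exact hx.2⟩
  let f := glueFun l r fun i => θ i
  let f' := glueFun l r fun i => (θ i).symm
  have h1 : Function.LeftInverse f' f :=
    glueFun_glueFun hd hmem fun i x => (θ i).symm_apply_apply x
  have h2 : Function.RightInverse f' f :=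
    glueFun_glueFun hd hmem' fun i x => (θ i).apply_symm_apply x
  have hout : ∀ c, (∀ i, c ∉ Ioo (l i) (r i)) → ∀ x, (x ≤ c → f x ≤ c) ∧ (c ≤ x → c ≤ f x) := by
    intro c hc x
    by_cases h : ∃ i, x ∈ Ioo (l i) (r i)
    · obtain ⟨i, hi⟩ := h
      have hfx : f x ∈ Ioo (l i) (r i) := by
        change glueFun _ _ _ _ ∈ _
        rw [glueFun_of_mem hd hi]; exact hmem i x hi
      have hci := hc i
      rw [mem_Ioo, not_and_or, not_lt, not_lt] at hci
      have h3 := hi.1; have h4 := hi.2; have h5 := hfx.1; have h6 := hfx.2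
      constructor <;> intro h7 <;> rcases hci with h8 | h8 <;> linarith
    · push Not at h
      have : f x = x := glueFun_of_notMem h
      rw [this]; exact ⟨id, id⟩
  have hmono : StrictMono f := by
    intro x y hxy
    by_cases h : ∃ c ∈ Icc x y, ∀ i, c ∉ Ioo (l i) (r i)
    · obtain ⟨c, hc, hci⟩ := h
      exact lt_of_le_of_ne (((hout c hci x).1 hc.1).trans ((hout c hci y).2 hc.2))
        fun h => hxy.ne (h1.injective h)
    · push Not at h
      obtain ⟨i, hi⟩ := h x ⟨le_rfl, hxy.le⟩
      have hy : y < r i := by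
        by_contra hy
        obtain ⟨j, hj⟩ := h (r i) ⟨hi.2.le, not_lt.1 hy⟩
        obtain ⟨z, hz1, hz2⟩ := exists_between (max_lt hj.1 (hi.1.trans hi.2))
        have := hd i j z ⟨(le_max_right _ _).trans_lt hz1, hz2⟩
          ⟨(le_max_left _ _).trans_lt hz1, hz2.trans hj.2⟩
        subst this
        exact lt_irrefl _ hj.2
      change glueFun _ _ _ _ < glueFun _ _ _ _
      rw [glueFun_of_mem hd hi, glueFun_of_mem hd ⟨hi.1.trans hxy, hy⟩]
      exact (θ i).strictMono hxy
  refine ⟨StrictMono.orderIsoOfRightInverse f hmono f' h2, fun i x hx => ?_, fun x hx => ?_⟩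
  · exact glueFun_of_mem (θ := fun i => θ i) hd hx
  · exact glueFun_of_notMem (θ := fun i => θ i) hx

/-- The order isomorphisms of `ℝ` that are the identity off `(u, v)` act transitively on `(u, v)`. -/
theorem exists_orderIso_affine {u s s' : ℝ} {v : ℝ} (hus : u < s) (hsv : s < v) (hus' : u < s')
    (hsv' : s' < v) : ∃ θ : ℝ ≃o ℝ, θ s = s' ∧ ∀ x, x ∉ Ioo u v → θ x = x := by
  -- On `[u, s]` and on `[s, v]` the map is affine.
  have h1 : 0 < s - u := by linarith
  have h2 : 0 < v - s := by linarith
  have h3 : 0 < s' - u := by linarith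
  have h4 : 0 < v - s' := by linarith
  let A : ∀ s s' : ℝ, ℝ → ℝ := fun s s' x =>
    if x ≤ u then x else if x ≤ s then u + (s' - u) / (s - u) * (x - u)
    else if x ≤ v then v - (v - s') / (v - s) * (v - x) else x
  have hA : ∀ s s' : ℝ, u < s → s < v → u < s' → s' < v → ∀ x,
      A s' s (A s s' x) = x := by
    intro s s' hus hsv hus' hsv' x
    have h1 : 0 < s - u := by linarith
    have h2 : 0 < v - s := by linarith
    have h3 : 0 < s' - u := by linarith
    have h4 : 0 < v - s' := by linarith
    simp only [A]
    by_cases c1 : x ≤ u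
    · simp [c1]
    by_cases c2 : x ≤ s
    · have e1 : 0 < (s' - u) / (s - u) * (x - u) := by
        have : 0 < x - u := by linarith
        positivity
      have e2 : (s' - u) / (s - u) * (x - u) ≤ s' - u := by
        rw [div_mul_eq_mul_div, div_le_iff₀ h1]
        exact mul_le_mul_of_nonneg_left (by linarith) h3.le
      rw [if_neg c1, if_pos c2, if_neg (by linarith), if_pos (by linarith)]
      field_simp; ring
    by_cases c3 : x ≤ v
    · have e1 : 0 ≤ (v - s') / (v - s) * (v - x) := by
        have : 0 ≤ v - x := by linarith
        positivity
      have e2 : (v - s') / (v - s) * (v - x) < v - s' := by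
        rw [div_mul_eq_mul_div, div_lt_iff₀ h2]
        exact mul_lt_mul_of_pos_left (by linarith) h4
      rw [if_neg c1, if_neg c2, if_pos c3, if_neg (by linarith), if_neg (by linarith),
        if_pos (by linarith)]
      field_simp; ring
    · have c4 : ¬ x ≤ s' := by linarith
      simp [c1, c2, c3, c4]
  have hm : StrictMono (A s s') := by
    intro x y hxy
    have key1 : ∀ z, u < z → z ≤ s → u < u + (s' - u) / (s - u) * (z - u) ∧
        u + (s' - u) / (s - u) * (z - u) ≤ s' := by
      intro z hz hz'
      have : 0 < z - u := by linarith
      refine ⟨by linarith [show 0 < (s' - u) / (s - u) * (z - u) by positivity], ?_⟩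
      have e2 : (s' - u) / (s - u) * (z - u) ≤ s' - u := by
        rw [div_mul_eq_mul_div, div_le_iff₀ h1]
        exact mul_le_mul_of_nonneg_left (by linarith) h3.le
      linarith
    have key2 : ∀ z, s < z → z ≤ v → s' < v - (v - s') / (v - s) * (v - z) ∧
        v - (v - s') / (v - s) * (v - z) ≤ v := by
      intro z hz hz'
      have : 0 ≤ v - z := by linarith
      refine ⟨?_, by linarith [show 0 ≤ (v - s') / (v - s) * (v - z) by positivity]⟩
      have e2 : (v - s') / (v - s) * (v - z) < v - s' := by
        rw [div_mul_eq_mul_div, div_lt_iff₀ h2]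
        exact mul_lt_mul_of_pos_left (by linarith) h4
      linarith
    have k1 := key1 x; have k2 := key1 y; have k3 := key2 x; have k4 := key2 y
    have k5 : (s' - u) / (s - u) * (x - u) < (s' - u) / (s - u) * (y - u) :=
      mul_lt_mul_of_pos_left (by linarith) (by positivity)
    have k6 : (v - s') / (v - s) * (v - y) < (v - s') / (v - s) * (v - x) :=
      mul_lt_mul_of_pos_left (by linarith) (by positivity)
    simp only [A]
    split_ifs with c1 c2 c3 c4 c5 c6 c7 c8 c9 c10 c11 c12 <;> (try simp only [not_le] at *) <;>
      first
      | linarith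
      | (have k1 := k1 (by assumption) (by assumption); have k4 := k4 (by assumption) (by assumption); linarith)
      | (have k2 := k2 (by assumption) (by assumption); linarith)
      | (have k4 := k4 (by assumption) (by assumption); linarith)
      | (have k1 := k1 (by assumption) (by assumption); linarith)
      | (have k3 := k3 (by assumption) (by assumption); linarith)
  refine ⟨StrictMono.orderIsoOfRightInverse _ hm (A s' s) (hA s' s hus' hsv' hus hsv), ?_, ?_⟩
  · change A s s' s = s'
    simp only [A]
    rw [if_neg (by linarith), if_pos le_rfl]
    field_simp; ring
  · intro x hx
    change A s s' x = x
    rw [mem_Ioo, not_and_or, not_lt, not_lt] at hx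
    simp only [A]
    split_ifs with c1 c2 c3
    · rfl
    · rcases hx with hx | hx <;> linarith
    · have : x = v := by rcases hx with hx | hx <;> linarith
      rw [this]; simp
    · rfl

/-- Two points of an open interval can be moved to any two points of it, in the same order, by an
order automorphism of the line that is the identity off the interval. -/
theorem exists_orderIso_pair {u v s t s' t' : ℝ} (hus : u < s) (hst : s < t) (htv : t < v)
    (hus' : u < s') (hst' : s' < t') (htv' : t' < v) :
    ∃ θ : ℝ ≃o ℝ, θ s = s' ∧ θ t = t' ∧ ∀ x, x ∉ Ioo u v → θ x = x := by
  obtain ⟨θ₁, h1, h2⟩ := exists_orderIso_affine hus (hst.trans htv) hus' (hst'.trans htv')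
  have h3 : s' < θ₁ t := by rw [← h1]; exact θ₁.strictMono hst
  have h4 : θ₁ t < v := by rw [← h2 v (by simp)]; exact θ₁.strictMono htv
  obtain ⟨θ₂, h5, h6⟩ := exists_orderIso_affine h3 h4 hst' htv'
  refine ⟨θ₁.trans θ₂, ?_, ?_, ?_⟩
  · simp [h1, h6 s' (by simp)]
  · simp [h5]
  · intro x hx
    simp only [OrderIso.trans_apply, h2 x hx]
    exact h6 x fun h => hx ⟨hus'.trans h.1, h.2⟩

/-! ### Detectable classes of intervals -/

/-- `D a b` says that the interval `[a, b]`, where `0 ≤ a < b ≤ 1`, belongs to a given family of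
intervals which contains all subintervals of its members. -/
structure IsDownset (D : ℝ → ℝ → Prop) : Prop where
  lt : ∀ {a b}, D a b → a < b
  nonneg : ∀ {a b}, D a b → 0 ≤ a
  le_one : ∀ {a b}, D a b → b ≤ 1
  mono : ∀ {a b a' b'}, D a b → a ≤ a' → a' < b' → b' ≤ b → D a' b'

/-- A set `M` of intervals `[a, b]` is detected, relative to `D`, when there are countably many pairs
of consecutive intervals `[α, β]`, `[γ, δ]` and an automorphism `θ` such that a member of `M`
contains infinitely many of the pairs, whereas an interval lying both in `D` and in its image under
`θ` has an overlap with both members of only finitely many pairs. The sum of rank-one operators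
mapping a unit vector of `[γ, δ]` to one of `[α, β]` then has noncompact compressions to the
members of `M` and compact compressions to the intervals in `D ∩ θ(D)`. -/
def IsDetected (D : ℝ → ℝ → Prop) (M : Set (ℝ × ℝ)) : Prop :=
  ∃ (θ : ℝ ≃o ℝ) (ι : Type) (_ : Countable ι) (α β γ δ : ι → ℝ), θ 0 = 0 ∧ θ 1 = 1 ∧
    (∀ i, 0 ≤ α i ∧ α i < β i ∧ β i ≤ γ i ∧ γ i < δ i ∧ δ i ≤ 1) ∧
    (∀ a b, (a, b) ∈ M → {i | a ≤ α i ∧ δ i ≤ b}.Infinite) ∧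
    ∀ a b, D a b → D (θ.symm a) (θ.symm b) → {i | a < β i ∧ γ i < b}.Finite

/-- The sets covered by finitely many detected ones. -/
inductive IsDetectable (D : ℝ → ℝ → Prop) : Set (ℝ × ℝ) → Prop
  | of {M : Set (ℝ × ℝ)} : IsDetected D M → IsDetectable D M
  | union {M₁ M₂ : Set (ℝ × ℝ)} : IsDetectable D M₁ → IsDetectable D M₂ → IsDetectable D (M₁ ∪ M₂)
  | mono {M₁ M₂ : Set (ℝ × ℝ)} : IsDetectable D M₁ → M₂ ⊆ M₁ → IsDetectable D M₂

/-- `x` is an interior point of an interval of `D`. -/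
def IsCovered (D : ℝ → ℝ → Prop) (x : ℝ) : Prop := ∃ a b, D a b ∧ a < x ∧ x < b

/-- `(u, v)` is a connected component of the set of points covered by `D`. -/
structure IsComponent (D : ℝ → ℝ → Prop) (u v : ℝ) : Prop where
  nonneg : 0 ≤ u
  lt : u < v
  le_one : v ≤ 1
  left : ¬ IsCovered D u
  right : ¬ IsCovered D v
  covered : ∀ x, u < x → x < v → IsCovered D x

theorem IsComponent.bounds {D : ℝ → ℝ → Prop} {u v a b x : ℝ} (h : IsComponent D u v) (hD : D a b)
    (hax : a < x) (hxb : x < b) (hux : u < x) (hxv : x < v) : u ≤ a ∧ b ≤ v := by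
  constructor
  · by_contra hc
    exact h.left ⟨a, b, hD, not_le.1 hc, hux.trans hxb⟩
  · by_contra hc
    exact h.right ⟨a, b, hD, hax.trans hxv, not_le.1 hc⟩

theorem IsComponent.eq_of_mem {D : ℝ → ℝ → Prop} {u v u' v' x : ℝ} (h : IsComponent D u v)
    (h' : IsComponent D u' v') (hx : x ∈ Ioo u v) (hx' : x ∈ Ioo u' v') : u = u' ∧ v = v' := by
  constructor
  · rcases lt_trichotomy u u' with hc | hc | hc
    · exact absurd (h.covered u' hc (hx'.1.trans hx.2)) h'.left
    · exact hc
    · exact absurd (h'.covered u hc (hx.1.trans hx'.2)) h.left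
  · rcases lt_trichotomy v v' with hc | hc | hc
    · exact absurd (h'.covered v (hx'.1.trans hx.2) hc) h.right
    · exact hc
    · exact absurd (h.covered v' (hx.1.trans hx'.2) hc) h'.right

theorem countable_components (D : ℝ → ℝ → Prop) {S : Set (ℝ × ℝ)}
    (hS : ∀ p ∈ S, IsComponent D p.1 p.2) : S.Countable := by
  have h : ∀ p : S, ∃ q : ℚ, (q : ℝ) ∈ Ioo p.1.1 p.1.2 := fun p =>
    exists_rat_btwn (hS p.1 p.2).lt
  choose q hq using h
  refine countable_coe_iff.1 (Function.Injective.countable (f := q) ?_)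
  intro p p' hpp
  have := (hS p.1 p.2).eq_of_mem (hS p'.1 p'.2) (hq p) (by rw [hpp]; exact hq p')
  exact Subtype.ext (Prod.ext this.1 this.2)

/-- Detection may be carried out separately in each component. -/
theorem isDetected_of_components {D : ℝ → ℝ → Prop} (hD : IsDownset D) {S : Set (ℝ × ℝ)}
    (hS : ∀ p ∈ S, IsComponent D p.1 p.2) (θ : ℝ × ℝ → ℝ ≃o ℝ)
    (hl : ∀ p ∈ S, θ p p.1 = p.1) (hr : ∀ p ∈ S, θ p p.2 = p.2) (α β γ δ : ℝ × ℝ → ℕ → ℝ)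
    (hq : ∀ p ∈ S, ∀ n, p.1 ≤ α p n ∧ α p n < β p n ∧ β p n ≤ γ p n ∧ γ p n < δ p n ∧ δ p n ≤ p.2)
    (hfin : ∀ p ∈ S, ∀ a b, p.1 ≤ a → b ≤ p.2 → D a b → D ((θ p).symm a) ((θ p).symm b) →
      {n | a < β p n ∧ γ p n < b}.Finite) :
    IsDetected D {e | ∃ p ∈ S, {n | e.1 ≤ α p n ∧ δ p n ≤ e.2}.Infinite} := by
  have hdisj : ∀ (i j : S) x, x ∈ Ioo i.1.1 i.1.2 → x ∈ Ioo j.1.1 j.1.2 → i = j := by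
    intro i j x hx hx'
    have := (hS i i.2).eq_of_mem (hS j j.2) hx hx'
    exact Subtype.ext (Prod.ext this.1 this.2)
  obtain ⟨Θ, h1, h2⟩ := exists_orderIso_glue (fun p : S => p.1.1) (fun p : S => p.1.2) hdisj
    (fun p : S => θ p) (fun p => hl p p.2) (fun p => hr p p.2)
  have hout : ∀ c, ¬ IsCovered D c → Θ c = c := fun c hc =>
    h2 c fun i hi => hc ((hS i i.2).covered c hi.1 hi.2)
  have hsymm : ∀ p : S, ∀ x ∈ Icc p.1.1 p.1.2, Θ.symm x = (θ p).symm x := by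
    intro p x hx
    rw [OrderIso.symm_apply_eq]
    have hcase : x = p.1.1 ∨ x = p.1.2 ∨ x ∈ Ioo p.1.1 p.1.2 := by
      rcases hx.1.eq_or_lt with h | h
      · exact Or.inl h.symm
      rcases hx.2.eq_or_lt with h' | h'
      · exact Or.inr (Or.inl h')
      · exact Or.inr (Or.inr ⟨h, h'⟩)
    rcases hcase with h | h | h
    · rw [h, (OrderIso.symm_apply_eq _).2 (hl p p.2).symm, hout _ (hS p p.2).left]
    · rw [h, (OrderIso.symm_apply_eq _).2 (hr p p.2).symm, hout _ (hS p p.2).right]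
    · have hm : (θ p).symm x ∈ Ioo p.1.1 p.1.2 :=
        ⟨by rw [OrderIso.lt_symm_apply, hl p p.2]; exact h.1,
          by rw [OrderIso.symm_apply_lt, hr p p.2]; exact h.2⟩
      rw [h1 p _ hm, OrderIso.apply_symm_apply]
  have : Countable S := countable_coe_iff.2 (countable_components D hS)
  refine ⟨Θ, S × ℕ, inferInstance, fun i => α i.1 i.2, fun i => β i.1 i.2, fun i => γ i.1 i.2,
    fun i => δ i.1 i.2, ?_, ?_, ?_, ?_, ?_⟩
  · exact hout _ fun ⟨a, b, h, h', _⟩ => absurd (hD.nonneg h) (not_le.2 h')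
  · exact hout _ fun ⟨a, b, h, _, h'⟩ => absurd (hD.le_one h) (not_le.2 h')
  · intro i
    obtain ⟨g1, g2, g3, g4, g5⟩ := hq i.1 i.1.2 i.2
    exact ⟨(hS i.1 i.1.2).nonneg.trans g1, g2, g3, g4, g5.trans (hS i.1 i.1.2).le_one⟩
  · rintro a b ⟨p, hp, hinf⟩
    refine (hinf.image (f := fun n => ((⟨p, hp⟩ : S), n)) fun m _ n _ h => (Prod.ext_iff.1 h).2).mono
      ?_
    rintro _ ⟨n, hn, rfl⟩
    exact hn
  · intro a b hab hab'
    -- An interval of `D` has an overlap with the pairs of at most one component.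
    have hin : ∀ i : S × ℕ, a < β i.1 i.2 ∧ γ i.1 i.2 < b → i.1.1.1 ≤ a ∧ b ≤ i.1.1.2 := by
      intro i hi
      obtain ⟨g1, g2, g3, g4, g5⟩ := hq i.1 i.1.2 i.2
      have hlt := hD.lt hab
      obtain ⟨x, hx1, hx2⟩ := exists_between
        (max_lt (lt_min hlt (show a < i.1.1.2 by linarith))
          (lt_min (show i.1.1.1 < b by linarith) (hS i.1 i.1.2).lt))
      rw [max_lt_iff] at hx1
      rw [lt_min_iff] at hx2
      exact (hS i.1 i.1.2).bounds hab hx1.1 hx2.1 hx1.2 hx2.2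
    by_cases hne : ∃ i : S × ℕ, a < β i.1 i.2 ∧ γ i.1 i.2 < b
    · obtain ⟨i, hi⟩ := hne
      have hi' := hin i hi
      have hlt := hD.lt hab
      refine ((hfin i.1 i.1.2 a b hi'.1 hi'.2 hab ?_).image fun n => (i.1, n)).subset ?_
      · rw [← hsymm i.1 a ⟨hi'.1, hlt.le.trans hi'.2⟩, ← hsymm i.1 b ⟨hi'.1.trans hlt.le, hi'.2⟩]
        exact hab'
      · rintro ⟨j, n⟩ hj
        have hj' := hin (j, n) hj
        obtain ⟨x, hx1, hx2⟩ := exists_between hlt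
        have : i.1 = j := hdisj i.1 j x ⟨hi'.1.trans_lt hx1, hx2.trans_le hi'.2⟩
          ⟨hj'.1.trans_lt hx1, hx2.trans_le hj'.2⟩
        subst this
        exact ⟨n, hj, rfl⟩
    · push Not at hne
      convert Set.finite_empty
      ext i
      simpa using hne i

/-- An interval `[s, t]` outside `D` can be squeezed into the interior of a prescribed interval
`[α, δ]` nearby, and the intervals in the image of `D` then do not contain `[α, δ]`. This can be done
simultaneously in disjoint blocks `(l, r)`. -/
theorem isDetected_of_blocks {D : ℝ → ℝ → Prop} (hD : IsDownset D) {ι : Type} [Countable ι]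
    (l r s t α δ : ι → ℝ)
    (hd : ∀ i j x, x ∈ Ioo (l i) (r i) → x ∈ Ioo (l j) (r j) → i = j)
    (h0 : ∀ i, 0 ≤ l i) (h1 : ∀ i, r i ≤ 1) (hls : ∀ i, l i < s i) (hst : ∀ i, s i < t i)
    (htr : ∀ i, t i < r i) (hD' : ∀ i, ¬ D (s i) (t i)) (hα : ∀ i, l i ≤ α i)
    (hαδ : ∀ i, α i < δ i) (hδ : ∀ i, δ i ≤ r i) :
    IsDetected D {e | ∃ i, e.1 ≤ α i ∧ δ i ≤ e.2} := by
  have hθ : ∀ i, ∃ θ : ℝ ≃o ℝ, θ (s i) = α i + (δ i - α i) / 3 ∧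
      θ (t i) = δ i - (δ i - α i) / 3 ∧ ∀ x, x ∉ Ioo (l i) (r i) → θ x = x := fun i =>
    exists_orderIso_pair (hls i) (hst i) (htr i) (by linarith [hα i, hαδ i])
      (by linarith [hαδ i]) (by linarith [hδ i, hαδ i])
  choose θ hs ht hfix using hθ
  obtain ⟨Θ, g1, g2⟩ := exists_orderIso_glue l r hd θ (fun i => hfix i _ (by simp))
    (fun i => hfix i _ (by simp))
  refine ⟨Θ, ι × ℕ, inferInstance, fun i => α i.1, fun i => α i.1 + (δ i.1 - α i.1) / 3,
    fun i => δ i.1 - (δ i.1 - α i.1) / 3, fun i => δ i.1, ?_, ?_, ?_, ?_, ?_⟩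
  · exact g2 _ fun i hi => by linarith [hi.1, h0 i]
  · exact g2 _ fun i hi => by linarith [hi.2, h1 i]
  · intro i
    have a1 := h0 i.1; have a2 := h1 i.1; have a3 := hα i.1; have a4 := hαδ i.1; have a5 := hδ i.1
    refine ⟨?_, ?_, ?_, ?_, ?_⟩ <;> linarith
  · rintro a b ⟨i, hi⟩
    refine (infinite_range_of_injective (f := fun n : ℕ => (i, n))
      fun m n h => (Prod.ext_iff.1 h).2).mono ?_
    rintro _ ⟨n, rfl⟩
    exact hi
  · intro a b _ hab
    convert Set.finite_empty
    ext i
    simp only [mem_ofPred_eq, mem_empty_iff_false, iff_false, not_and, not_lt]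
    intro h3
    by_contra h4
    push Not at h4
    refine hD' i.1 (hD.mono hab ?_ (hst i.1) ?_)
    · rw [OrderIso.symm_apply_le, g1 i.1 _ ⟨hls i.1, (hst i.1).trans (htr i.1)⟩, hs]
      exact h3.le
    · rw [OrderIso.le_symm_apply, g1 i.1 _ ⟨(hls i.1).trans (hst i.1), htr i.1⟩, ht]
      exact h4.le

/-! ### Detecting the intervals outside a family -/

theorem exists_forall_mul_inv_lt {w x : ℝ} (hw : 0 < w) (hx : 0 < x) :
    ∃ N : ℕ, ∀ n ≥ N, w * ((n : ℝ) + 2)⁻¹ < x := by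
  obtain ⟨N, hN⟩ := exists_nat_gt (w / x)
  refine ⟨N, fun n hn => ?_⟩
  have h1 : (N : ℝ) ≤ n := by exact_mod_cast hn
  have h2 : (0 : ℝ) < (n : ℝ) + 2 := by positivity
  rw [← div_eq_mul_inv, div_lt_iff₀ h2]
  rw [div_lt_iff₀ hx] at hN
  nlinarith

theorem infinite_of_forall_ge {s : Set ℕ} (N : ℕ) (h : ∀ n ≥ N, n ∈ s) : s.Infinite :=
  (Ici_infinite N).mono h

theorem finite_of_forall_ge {s : Set ℕ} (N : ℕ) (h : ∀ n ≥ N, n ∉ s) : s.Finite :=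
  (finite_lt_nat N).subset fun n hn => not_le.1 fun hc => h n hc hn

theorem mul_inv_add_two_bounds {w : ℝ} (hw : 0 < w) (n : ℕ) :
    0 < w * ((n : ℝ) + 2)⁻¹ ∧ w * ((n : ℝ) + 2)⁻¹ ≤ w / 2 := by
  have h : (2 : ℝ) ≤ (n : ℝ) + 2 := by linarith [Nat.cast_nonneg (α := ℝ) n]
  refine ⟨by positivity, ?_⟩
  rw [div_eq_mul_inv]
  exact mul_le_mul_of_nonneg_left (inv_anti₀ (by norm_num) h) hw.le

/-- Intervals with an uncovered interior point are detected by pairs which approach, from both sides,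
the points of a countable dense set of uncovered points. -/
theorem isDetected_crossing (D : ℝ → ℝ → Prop) :
    IsDetected D {e | ∃ c, 0 < c ∧ c < 1 ∧ ¬ IsCovered D c ∧ e.1 < c ∧ c < e.2} := by
  obtain ⟨T, hTs, hTc, hTd⟩ := (TopologicalSpace.IsSeparable.of_separableSpace
    {c | 0 < c ∧ c < 1 ∧ ¬ IsCovered D c}).exists_countable_dense_subset
  have : Countable T := hTc.to_subtype
  refine ⟨OrderIso.refl ℝ, T × ℕ, inferInstance,
    fun i => i.1.1 - i.1.1 * ((i.2 : ℝ) + 2)⁻¹, fun i => i.1.1, fun i => i.1.1,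
    fun i => i.1.1 + (1 - i.1.1) * ((i.2 : ℝ) + 2)⁻¹, rfl, rfl, ?_, ?_, ?_⟩
  · rintro ⟨⟨c, hc⟩, n⟩
    obtain ⟨h0, h1, -⟩ := hTs hc
    have h3 := mul_inv_add_two_bounds h0 n
    have h4 := mul_inv_add_two_bounds (sub_pos.2 h1) n
    refine ⟨?_, ?_, le_rfl, ?_, ?_⟩ <;> dsimp only <;> linarith
  · rintro a b ⟨c, h0, h1, hc, ha, hb⟩
    obtain ⟨c', hc', hcT⟩ := mem_closure_iff.1 (hTd ⟨h0, h1, hc⟩) (Ioo a b) isOpen_Ioo ⟨ha, hb⟩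
    obtain ⟨h0', h1', -⟩ := hTs hcT
    obtain ⟨N, hN⟩ := exists_forall_mul_inv_lt h0' (sub_pos.2 hc'.1)
    obtain ⟨N', hN'⟩ := exists_forall_mul_inv_lt (sub_pos.2 h1') (sub_pos.2 hc'.2)
    refine ((Ici_infinite (max N N')).image (f := fun n => ((⟨c', hcT⟩ : T), n))
      fun m _ n _ h => (Prod.ext_iff.1 h).2).mono ?_
    rintro _ ⟨n, hn, rfl⟩
    have h2 := hN n ((le_max_left _ _).trans hn)
    have h3 := hN' n ((le_max_right _ _).trans hn)
    constructor <;> dsimp only <;> linarith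
  · intro a b hab _
    convert Set.finite_empty
    ext ⟨⟨c, hc⟩, n⟩
    simp only [mem_ofPred_eq, mem_empty_iff_false, iff_false]
    exact fun h => (hTs hc).2.2 ⟨a, b, hab, h.1, h.2⟩

/-- A component whose closure is not in `D` is detected by pairs approaching its two ends. -/
theorem isDetectable_component {D : ℝ → ℝ → Prop} (hD : IsDownset D) :
    IsDetectable D {e | IsComponent D e.1 e.2 ∧ ¬ D e.1 e.2} := by
  have h := isDetected_of_components hD (S := {p | IsComponent D p.1 p.2 ∧ ¬ D p.1 p.2})
    (fun p hp => hp.1) (fun _ => OrderIso.refl ℝ) (fun _ _ => rfl) (fun _ _ => rfl)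
    (fun p _ => p.1) (fun p n => p.1 + (p.2 - p.1) * ((n : ℝ) + 2)⁻¹)
    (fun p n => p.2 - (p.2 - p.1) * ((n : ℝ) + 2)⁻¹) (fun p _ => p.2) ?_ ?_
  · exact (IsDetectable.of h).mono fun e he =>
      ⟨e, he, infinite_of_forall_ge 0 fun n _ => ⟨le_rfl, le_rfl⟩⟩
  · rintro p ⟨hp, -⟩ n
    have := mul_inv_add_two_bounds (sub_pos.2 hp.lt) n
    refine ⟨le_rfl, ?_, ?_, ?_, le_rfl⟩ <;> linarith
  · rintro p ⟨hp, hbad⟩ a b ha hb hab _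
    have hw := sub_pos.2 hp.lt
    rcases ha.eq_or_lt with ha' | ha'
    · rcases hb.eq_or_lt with hb' | hb'
      · rw [ha', ← hb'] at hbad
        exact absurd hab hbad
      · obtain ⟨N, hN⟩ := exists_forall_mul_inv_lt hw (sub_pos.2 hb')
        exact finite_of_forall_ge N fun n hn hc => by linarith [hc.2, hN n hn]
    · obtain ⟨N, hN⟩ := exists_forall_mul_inv_lt hw (sub_pos.2 ha')
      exact finite_of_forall_ge N fun n hn hc => by linarith [hc.1, hN n hn]

/-- Intervals outside `D` which reach the right end `v` of their component, but not its left end,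
are detected as follows. If `D` contains no interval with right end `v`, use pairs approaching `v`
from the left. Otherwise let `a₀` be the infimum of the left ends of such intervals; push `a₀` to the
right by an automorphism `θ`, and use pairs of which the first member is `[a₀, θ a₀]` and the second
one approaches `v`. -/
theorem isDetectable_right_end {D : ℝ → ℝ → Prop} (hD : IsDownset D) :
    IsDetectable D {e | ∃ u, IsComponent D u e.2 ∧ u < e.1 ∧ e.1 < e.2 ∧ ¬ D e.1 e.2} := by
  have h₁ := isDetected_of_components hD
    (S := {p | IsComponent D p.1 p.2 ∧ ∀ a, p.1 < a → ¬ D a p.2})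
    (fun p hp => hp.1) (fun _ => OrderIso.refl ℝ) (fun _ _ => rfl) (fun _ _ => rfl)
    (fun p n => p.2 - (p.2 - p.1) * ((n : ℝ) + 2)⁻¹)
    (fun p n => p.2 - (p.2 - p.1) * ((n : ℝ) + 2)⁻¹ / 2)
    (fun p n => p.2 - (p.2 - p.1) * ((n : ℝ) + 2)⁻¹ / 2) (fun p _ => p.2) ?_ ?_
  · let a₀ : ℝ × ℝ → ℝ := fun p => sInf {a | p.1 < a ∧ D a p.2}
    let S : Set (ℝ × ℝ) := {p | IsComponent D p.1 p.2 ∧ (∃ a, p.1 < a ∧ D a p.2) ∧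
      ∃ a, p.1 < a ∧ a < p.2 ∧ ¬ D a p.2}
    have hle : ∀ p : ℝ × ℝ, ∀ a, p.1 ≤ a → D a p.2 → a₀ p ≤ a := by
      intro p a ha hab
      by_contra hc
      push Not at hc
      obtain ⟨x, hx1, hx2⟩ := exists_between (lt_min hc (hD.lt hab))
      rw [lt_min_iff] at hx2
      exact absurd (csInf_le ⟨p.1, fun y hy => hy.1.le⟩
        (show x ∈ {a | p.1 < a ∧ D a p.2} from ⟨ha.trans_lt hx1, hD.mono hab hx1.le hx2.2 le_rfl⟩))
        (not_le.2 hx2.1)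
    have hge : ∀ p : ℝ × ℝ, (∃ a, p.1 < a ∧ D a p.2) → ∀ a, a < p.2 → ¬ D a p.2 → a ≤ a₀ p := by
      intro p hne a ha hab
      refine le_csInf hne fun x hx => ?_
      by_contra hc
      exact hab (hD.mono hx.2 (not_le.1 hc).le ha le_rfl)
    have hS : ∀ p ∈ S, p.1 < a₀ p ∧ a₀ p < p.2 := by
      rintro p ⟨-, ⟨x, hx, hx'⟩, a, ha, hav, hab⟩
      exact ⟨ha.trans_le (hge p ⟨x, hx, hx'⟩ a hav hab),
        (hle p x hx.le hx').trans_lt (hD.lt hx')⟩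
    have hθ : ∀ p, ∃ θ : ℝ ≃o ℝ, p ∈ S → θ (a₀ p) = (a₀ p + p.2) / 2 ∧
        ∀ x, x ∉ Ioo p.1 p.2 → θ x = x := by
      intro p
      by_cases hp : p ∈ S
      · obtain ⟨h1, h2⟩ := hS p hp
        obtain ⟨θ, hθ⟩ := exists_orderIso_affine h1 h2 (show p.1 < (a₀ p + p.2) / 2 by linarith)
          (by linarith)
        exact ⟨θ, fun _ => hθ⟩
      · exact ⟨OrderIso.refl ℝ, fun h => absurd h hp⟩
    choose θ hθ using hθ
    have h₂ := isDetected_of_components hD (S := S) (fun p hp => hp.1) θ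
      (fun p hp => (hθ p hp).2 _ (by simp)) (fun p hp => (hθ p hp).2 _ (by simp))
      (fun p _ => a₀ p) (fun p _ => (a₀ p + p.2) / 2)
      (fun p n => p.2 - (p.2 - a₀ p) * ((n : ℝ) + 2)⁻¹) (fun p _ => p.2) ?_ ?_
    · refine ((IsDetectable.of h₁).union (IsDetectable.of h₂)).mono ?_
      rintro ⟨a, v⟩ ⟨u, hu, hua, hav, hbad⟩
      by_cases hR : ∃ a, u < a ∧ D a v
      · exact Or.inr ⟨(u, v), ⟨hu, hR, a, hua, hav, hbad⟩,
          infinite_of_forall_ge 0 fun n _ => ⟨hge (u, v) hR a hav hbad, le_rfl⟩⟩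
      · push Not at hR
        obtain ⟨N, hN⟩ := exists_forall_mul_inv_lt (sub_pos.2 hu.lt) (sub_pos.2 hav)
        refine Or.inl ⟨(u, v), ⟨hu, hR⟩, infinite_of_forall_ge N fun n hn => ⟨?_, le_rfl⟩⟩
        have := hN n hn
        dsimp only at *
        linarith
    · intro p hp n
      obtain ⟨h1, h2⟩ := hS p hp
      have := mul_inv_add_two_bounds (sub_pos.2 h2) n
      refine ⟨h1.le, ?_, ?_, ?_, le_rfl⟩ <;> linarith
    · intro p hp a b ha hb hab hab'
      obtain ⟨h1, h2⟩ := hS p hp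
      rcases hb.eq_or_lt with hb' | hb'
      · refine finite_of_forall_ge 0 fun n _ hc => ?_
        have e1 : (θ p).symm p.2 = p.2 := by
          rw [OrderIso.symm_apply_eq, (hθ p hp).2 _ (by simp)]
        have e2 : (θ p).symm p.1 = p.1 := by
          rw [OrderIso.symm_apply_eq, (hθ p hp).2 _ (by simp)]
        rw [hb', e1] at hab'
        have e3 : p.1 ≤ (θ p).symm a := by
          rw [← e2]; exact (θ p).symm.monotone ha
        have e4 := hle p _ e3 hab'
        rw [OrderIso.le_symm_apply, (hθ p hp).1] at e4
        exact absurd hc.1 (not_lt.2 e4)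
      · obtain ⟨N, hN⟩ := exists_forall_mul_inv_lt (sub_pos.2 h2) (sub_pos.2 hb')
        exact finite_of_forall_ge N fun n hn hc => by linarith [hc.2, hN n hn]
  · rintro p ⟨hp, -⟩ n
    have := mul_inv_add_two_bounds (sub_pos.2 hp.lt) n
    refine ⟨?_, ?_, ?_, ?_, le_rfl⟩ <;> linarith
  · rintro p ⟨hp, hbad⟩ a b ha hb hab _
    rcases hb.eq_or_lt with hb' | hb'
    · obtain ⟨x, hx1, hx2⟩ := exists_between (hD.lt hab)
      exact absurd (hD.mono hab hx1.le hx2 le_rfl) (hb' ▸ hbad x (ha.trans_lt hx1))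
    · obtain ⟨N, hN⟩ := exists_forall_mul_inv_lt (sub_pos.2 hp.lt) (sub_pos.2 hb')
      exact finite_of_forall_ge N fun n hn hc => by linarith [hc.2, hN n hn,
        (mul_inv_add_two_bounds (sub_pos.2 hp.lt) n).1]

/-- Intervals outside `D` around the midpoint `m` of their component that extend at least as far to
the right of `m` as to the left contain a fixed interval `[m, m + ε]`; some interval outside `D` is
squeezed into it. -/
theorem isDetectable_middle {D : ℝ → ℝ → Prop} (hD : IsDownset D) :
    IsDetectable D {e | ∃ u v, IsComponent D u v ∧ u < e.1 ∧ e.2 < v ∧ e.1 < (u + v) / 2 ∧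
      (u + v) / 2 < e.2 ∧ u + v ≤ e.1 + e.2 ∧ ¬ D e.1 e.2} := by
  let S : Set (ℝ × ℝ) := {p | IsComponent D p.1 p.2 ∧
    ∃ s t, p.1 < s ∧ s < t ∧ t < p.2 ∧ ¬ D s t}
  have : Countable S := countable_coe_iff.2 (countable_components D fun p hp => hp.1)
  have hε : ∀ p : S, ∃ ε : ℝ, 0 < ε ∧ (p.1.1 + p.1.2) / 2 + ε ≤ p.1.2 ∧
      D ((p.1.1 + p.1.2) / 2 - ε) ((p.1.1 + p.1.2) / 2 + ε) := by
    rintro ⟨p, hp, -⟩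
    have hlt := hp.lt
    obtain ⟨a, b, hab, ha, hb⟩ := hp.covered ((p.1 + p.2) / 2) (by linarith) (by linarith)
    have hbd := hp.bounds hab ha hb (by linarith) (by linarith)
    have hpos : 0 < min ((p.1 + p.2) / 2 - a) (b - (p.1 + p.2) / 2) :=
      lt_min (by linarith) (by linarith)
    have h1 := min_le_left ((p.1 + p.2) / 2 - a) (b - (p.1 + p.2) / 2)
    have h2 := min_le_right ((p.1 + p.2) / 2 - a) (b - (p.1 + p.2) / 2)
    exact ⟨_, hpos, by dsimp only; linarith, hD.mono hab (by linarith) (by linarith) (by linarith)⟩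
  choose ε hε0 hεv hεD using hε
  have hS : ∀ p : S, ∃ s t, p.1.1 < s ∧ s < t ∧ t < p.1.2 ∧ ¬ D s t := fun p => p.2.2
  choose s t hs hst ht hbad using hS
  have h := isDetected_of_blocks hD (ι := S) (fun p => p.1.1) (fun p => p.1.2) s t
    (fun p => (p.1.1 + p.1.2) / 2) (fun p => (p.1.1 + p.1.2) / 2 + ε p)
    (fun i j x hx hx' => by
      have := i.2.1.eq_of_mem j.2.1 hx hx'
      exact Subtype.ext (Prod.ext this.1 this.2))
    (fun p => p.2.1.nonneg) (fun p => p.2.1.le_one) hs hst ht hbad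
    (fun p => by linarith [p.2.1.lt]) (fun p => by linarith [hε0 p]) hεv
  refine (IsDetectable.of h).mono ?_
  rintro ⟨a, b⟩ ⟨u, v, hc, hua, hbv, ham, hmb, hsum, hab⟩
  dsimp only at *
  let p : S := ⟨(u, v), hc, a, b, hua, ham.trans hmb, hbv, hab⟩
  refine ⟨p, ham.le, ?_⟩
  have h2 : D ((u + v) / 2 - ε p) ((u + v) / 2 + ε p) := hεD p
  by_contra hcon
  have hcon : b < (u + v) / 2 + ε p := not_le.1 hcon
  exact hab (hD.mono h2 (by linarith) (ham.trans hmb) hcon.le)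

/-- In a component `(u, v)`, choose points `X₁ < X₂ < …` greedily, starting from the midpoint: with
`g x = sup {b | D x b}`, the point following `x` lies close to `g x` on its left. -/
theorem IsComponent.exists_greedy {D : ℝ → ℝ → Prop} (hD : IsDownset D) {u v : ℝ}
    (h : IsComponent D u v) : ∃ X δ : ℕ → ℝ, StrictMono X ∧ X 0 = u ∧ (∀ n, X n < v) ∧
      (∀ k, X (k + 2) < δ k ∧ δ k ≤ X (k + 3)) ∧
      ∀ a b, (u + v) / 2 ≤ a → a < b → b < v → ¬ D a b →
        ∃ k, ¬ D (X (k + 1)) (X (k + 3)) ∧ a ≤ X (k + 2) ∧ δ k ≤ b := by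
  have huv := h.lt
  let g : ℝ → ℝ := fun x => sSup {b | D x b}
  have hne : ∀ x, u < x → x < v → ∃ b, D x b := by
    intro x hx hx'
    obtain ⟨a, b, hab, ha, hb⟩ := h.covered x hx hx'
    exact ⟨b, hD.mono hab ha.le hb le_rfl⟩
  have hbv : ∀ x, x < v → v ∈ upperBounds {b | D x b} := by
    intro x hx b hb
    by_contra hc
    exact h.right ⟨x, b, hb, hx, not_le.1 hc⟩
  have hgv : ∀ x, u < x → x < v → g x ≤ v := fun x hx hx' => csSup_le (hne x hx hx') (hbv x hx')
  have hleg : ∀ x b, x < v → D x b → b ≤ g x := fun x b hx hb => le_csSup ⟨v, hbv x hx⟩ hb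
  have hxg : ∀ x, u < x → x < v → x < g x := by
    intro x hx hx'
    obtain ⟨b, hb⟩ := hne x hx hx'
    exact (hD.lt hb).trans_le (hleg x b hx' hb)
  have hgD : ∀ x b, u < x → x < v → x < b → b < g x → D x b := by
    intro x b hx hx' hxb hb
    obtain ⟨b', hb', hlt⟩ := exists_lt_of_lt_csSup (hne x hx hx') hb
    exact hD.mono hb' le_rfl hxb hlt.le
  have hgmono : ∀ x y, u < x → x ≤ y → y < v → g x ≤ g y := by
    intro x y hx hxy hy
    refine csSup_le (hne x hx (hxy.trans_lt hy)) fun b hb => ?_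
    rcases le_or_gt b y with hby | hby
    · exact hby.trans (hxg y (hx.trans_le hxy) hy).le
    · exact hleg y b hy (hD.mono hb hxy hby le_rfl)
  -- One greedy step, from `x` to `x'`; the lower bound `ℓ` keeps the step from being too short.
  have hstep : ∀ p : ℝ × ℝ, ∃ x', u < p.1 → p.1 < v → p.2 < g p.1 →
      p.1 < x' ∧ x' < v ∧ p.2 < x' ∧ x' < g p.1 ∧ (g p.1 < v → g p.1 < g x') := by
    rintro ⟨x, ℓ⟩
    by_cases hx : u < x ∧ x < v ∧ ℓ < g x
    · obtain ⟨hx, hx', hℓ⟩ := hx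
      have h1 := hxg x hx hx'
      by_cases hg : g x < v
      · obtain ⟨a, b, hab, ha, hb⟩ := h.covered (g x) (hx.trans h1) hg
        obtain ⟨x', h2, h3⟩ := exists_between (max_lt ha (max_lt h1 hℓ))
        rw [max_lt_iff, max_lt_iff] at h2
        refine ⟨x', fun _ _ _ => ⟨h2.2.1, h3.trans hg, h2.2.2, h3, fun _ => ?_⟩⟩
        exact hb.trans_le (hleg x' b (h3.trans hg) (hD.mono hab h2.1.le (h3.trans hb) le_rfl))
      · obtain ⟨x', h2, h3⟩ := exists_between (max_lt h1 hℓ)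
        rw [max_lt_iff] at h2
        exact ⟨x', fun _ _ _ => ⟨h2.1, h3.trans_le (hgv x hx hx'), h2.2, h3, fun h => absurd h hg⟩⟩
    · exact ⟨0, fun h1 h2 h3 => absurd ⟨h1, h2, h3⟩ hx⟩
  choose nxt hnxt using hstep
  let low : ℝ → ℝ := fun x => if g x < v then g x else x
  let st : ℕ → ℝ × ℝ := fun n => Nat.rec ((u + v) / 2, u) (fun _ p => (nxt p, low p.1)) n
  let x : ℕ → ℝ := fun n => (st n).1
  have hx0 : x 0 = (u + v) / 2 := rfl
  have hst : ∀ n, st (n + 1) = (nxt (st n), low (st n).1) := fun n => rfl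
  have hinv : ∀ n, u < x n ∧ x n < v ∧ (st n).2 < g (x n) := by
    intro n
    induction n with
    | zero =>
      have h1 : u < (u + v) / 2 := by linarith
      have h2 : (u + v) / 2 < v := by linarith
      exact ⟨h1, h2, h1.trans (hxg _ h1 h2)⟩
    | succ n ih =>
      obtain ⟨h1, h2, h3⟩ := ih
      obtain ⟨k1, k2, k3, k4, k5⟩ := hnxt (st n) h1 h2 h3
      have h4 : u < x (n + 1) := h1.trans k1
      refine ⟨h4, k2, ?_⟩
      change (if g (x n) < v then g (x n) else x n) < g (x (n + 1))
      split_ifs with hg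
      · exact k5 hg
      · exact k1.trans (hxg _ h4 k2)
  have hprop : ∀ n, x n < x (n + 1) ∧ x (n + 1) < g (x n) := fun n =>
    let k := hnxt (st n) (hinv n).1 (hinv n).2.1 (hinv n).2.2
    ⟨k.1, k.2.2.2.1⟩
  have hskip : ∀ n, g (x n) < v → g (x n) < x (n + 2) := by
    intro n hg
    have k := (hnxt (st (n + 1)) (hinv (n + 1)).1 (hinv (n + 1)).2.1 (hinv (n + 1)).2.2).2.2.1
    have e : (st (n + 1)).2 = g (x n) := if_pos hg
    rw [e] at k
    exact k
  let X : ℕ → ℝ := fun n => Nat.casesOn n u x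
  refine ⟨X, fun k => min (x (k + 2)) (g (x k)), ?_, rfl, ?_, ?_, ?_⟩
  · refine strictMono_nat_of_lt_succ fun n => ?_
    cases n with
    | zero => exact (hinv 0).1
    | succ n => exact (hprop n).1
  · intro n
    cases n with
    | zero => exact huv
    | succ n => exact (hinv n).2.1
  · exact fun k => ⟨lt_min (hprop (k + 1)).1 (hprop k).2, min_le_left _ _⟩
  · intro a b ha hab hbv' hbad
    have hua : u < a := by linarith
    have hav : a < v := hab.trans hbv'
    have hgab : g a ≤ b := not_lt.1 fun hc => hbad (hgD a b hua hav hab hc)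
    have hex : ∃ k, x k ≤ a ∧ a < x (k + 1) := by
      by_contra hcon
      push Not at hcon
      have hall : ∀ k, x k ≤ a := by
        intro k
        induction k with
        | zero => exact ha
        | succ k ih => exact hcon k ih
      -- The points `x k` would accumulate at a covered point, which the greedy choice jumps over.
      have hbdd : BddAbove (range x) := ⟨a, by rintro _ ⟨k, rfl⟩; exact hall k⟩
      have hL : ∀ k, x k ≤ sSup (range x) := fun k => le_csSup hbdd ⟨k, rfl⟩
      have hLa : sSup (range x) ≤ a := csSup_le (range_nonempty x) (by rintro _ ⟨k, rfl⟩; exact hall k)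
      obtain ⟨a', b', hab', ha', hb'⟩ := h.covered (sSup (range x)) ((hinv 0).1.trans_le (hL 0))
        (hLa.trans_lt hav)
      obtain ⟨_, ⟨k, rfl⟩, hk⟩ := exists_lt_of_lt_csSup (range_nonempty x) ha'
      have h1 := hleg (x k) b' (hinv k).2.1 (hD.mono hab' hk.le ((hL k).trans_lt hb') le_rfl)
      have h2 := hskip k (((hgmono _ _ (hinv k).1 (hall k) hav).trans hgab).trans_lt hbv')
      linarith [hL (k + 2)]
    obtain ⟨k, hk, hk'⟩ := hex
    have h1 : g (x k) ≤ b := (hgmono _ _ (hinv k).1 hk hav).trans hgab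
    refine ⟨k, fun hc => ?_, hk'.le, (min_le_right _ _).trans h1⟩
    exact absurd (hleg _ _ (hinv k).2.1 hc) (not_le.2 (hskip k (h1.trans_lt hbv')))

/-- Intervals outside `D` in the right half of their component are detected by means of the greedy
points `X k`. Each such interval contains one of the gaps `[X (k + 2), δ k]` for which
`[X (k + 1), X (k + 3)]` is not in `D`; the latter interval is squeezed into the gap. The blocks
`(X k, X (k + 4))` in which this takes place are disjoint when `k` is restricted to a residue class
modulo `4`. -/
theorem isDetectable_right_half {D : ℝ → ℝ → Prop} (hD : IsDownset D) :
    IsDetectable D {e | ∃ u v, IsComponent D u v ∧ (u + v) / 2 ≤ e.1 ∧ e.1 < e.2 ∧ e.2 < v ∧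
      ¬ D e.1 e.2} := by
  let S : Set (ℝ × ℝ) := {p | IsComponent D p.1 p.2}
  have : Countable S := countable_coe_iff.2 (countable_components D fun p hp => hp)
  have hg := fun p : S => IsComponent.exists_greedy hD p.2
  choose X δ hX hX0 hXv hδ hbad using hg
  have key : ∀ j : ℕ, IsDetectable D {e | ∃ p : S, ∃ k, ¬ D (X p (k + 1)) (X p (k + 3)) ∧
      k % 4 = j ∧ e.1 ≤ X p (k + 2) ∧ δ p k ≤ e.2} := by
    intro j
    let T : Set (S × ℕ) := {i | ¬ D (X i.1 (i.2 + 1)) (X i.1 (i.2 + 3)) ∧ i.2 % 4 = j}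
    have hXu : ∀ p k, p.1.1 ≤ X p k := fun p k => by
      rw [← hX0 p]; exact (hX p).monotone (Nat.zero_le k)
    have h := isDetected_of_blocks hD (ι := T) (fun i => X i.1.1 i.1.2)
      (fun i => X i.1.1 (i.1.2 + 4)) (fun i => X i.1.1 (i.1.2 + 1)) (fun i => X i.1.1 (i.1.2 + 3))
      (fun i => X i.1.1 (i.1.2 + 2)) (fun i => δ i.1.1 i.1.2) ?_
      (fun i => i.1.1.2.nonneg.trans (hXu _ _)) (fun i => (hXv _ _).le.trans i.1.1.2.le_one)
      (fun i => hX _ (by lia)) (fun i => hX _ (by lia)) (fun i => hX _ (by lia))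
      (fun i => i.2.1) (fun i => (hX _).monotone (by lia)) (fun i => (hδ _ _).1)
      (fun i => (hδ _ _).2.trans ((hX _).monotone (by lia)))
    · refine (IsDetectable.of h).mono ?_
      rintro e ⟨p, k, h1, h2, h3⟩
      exact ⟨⟨(p, k), h1, h2⟩, h3⟩
    · rintro ⟨⟨p, k⟩, hk, hkj⟩ ⟨⟨p', k'⟩, hk', hkj'⟩ x hx hx'
      dsimp only at *
      have hpp : p = p' := by
        have := IsComponent.eq_of_mem p.2 p'.2 (x := x)
          ⟨(hXu _ _).trans_lt hx.1, hx.2.trans (hXv _ _)⟩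
          ⟨(hXu _ _).trans_lt hx'.1, hx'.2.trans (hXv _ _)⟩
        exact Subtype.ext (Prod.ext this.1 this.2)
      subst hpp
      have h1 : k < k' + 4 := (hX p).lt_iff_lt.1 (hx.1.trans hx'.2)
      have h2 : k' < k + 4 := (hX p).lt_iff_lt.1 (hx'.1.trans hx.2)
      have : k = k' := by lia
      subst this
      rfl
  refine ((((key 0).union (key 1)).union (key 2)).union (key 3)).mono ?_
  rintro ⟨a, b⟩ ⟨u, v, hc, hm, hab, hbv, hD'⟩
  obtain ⟨k, h1, h2, h3⟩ := hbad ⟨(u, v), hc⟩ a b hm hab hbv hD'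
  have h4 : k % 4 = 0 ∨ k % 4 = 1 ∨ k % 4 = 2 ∨ k % 4 = 3 := by lia
  rcases h4 with h4 | h4 | h4 | h4
  · exact Or.inl (Or.inl (Or.inl ⟨_, k, h1, h4, h2, h3⟩))
  · exact Or.inl (Or.inl (Or.inr ⟨_, k, h1, h4, h2, h3⟩))
  · exact Or.inl (Or.inr ⟨_, k, h1, h4, h2, h3⟩)
  · exact Or.inr ⟨_, k, h1, h4, h2, h3⟩

/-- The intervals `[a, b]` outside `D` which lie in the closure of a component `(u, v)`, do not reach
`u`, and have a midpoint at least that of the component. -/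
def rightOutside (D : ℝ → ℝ → Prop) : Set (ℝ × ℝ) :=
  {e | ∃ u v, IsComponent D u v ∧ u < e.1 ∧ e.1 < e.2 ∧ e.2 ≤ v ∧ u + v ≤ e.1 + e.2 ∧ ¬ D e.1 e.2}

theorem isDetectable_rightOutside {D : ℝ → ℝ → Prop} (hD : IsDownset D) :
    IsDetectable D (rightOutside D) := by
  refine (((isDetectable_right_end hD).union (isDetectable_middle hD)).union
    (isDetectable_right_half hD)).mono ?_
  rintro ⟨a, b⟩ ⟨u, v, hc, hua, hab, hbv, hsum, hbad⟩
  dsimp only at *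
  rcases hbv.eq_or_lt with h | h
  · subst h
    exact Or.inl (Or.inl ⟨u, hc, hua, hab, hbad⟩)
  · rcases lt_or_ge a ((u + v) / 2) with h' | h'
    · exact Or.inl (Or.inr ⟨u, v, hc, hua, h, h', by dsimp only; linarith, hsum, hbad⟩)
    · exact Or.inr ⟨u, v, hc, h', hab, h, hbad⟩

/-! ### Reflection -/

/-- The family of the reflected intervals `[1 - b, 1 - a]`. -/
def reflect (D : ℝ → ℝ → Prop) : ℝ → ℝ → Prop := fun a b => D (1 - b) (1 - a)

theorem IsDownset.reflect {D : ℝ → ℝ → Prop} (hD : IsDownset D) : IsDownset (reflect D) where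
  lt h := by have := hD.lt h; linarith
  nonneg h := by have := hD.le_one h; linarith
  le_one h := by have := hD.nonneg h; linarith
  mono h h1 h2 h3 := hD.mono h (by linarith) (by linarith) (by linarith)

theorem isCovered_reflect {D : ℝ → ℝ → Prop} {x : ℝ} :
    IsCovered (reflect D) x ↔ IsCovered D (1 - x) := by
  constructor
  · rintro ⟨a, b, h, h1, h2⟩
    exact ⟨1 - b, 1 - a, h, by linarith, by linarith⟩
  · rintro ⟨a, b, h, h1, h2⟩
    exact ⟨1 - b, 1 - a, by simpa [reflect] using h, by linarith, by linarith⟩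

theorem IsComponent.reflect {D : ℝ → ℝ → Prop} {u v : ℝ} (h : IsComponent D u v) :
    IsComponent (reflect D) (1 - v) (1 - u) where
  nonneg := by linarith [h.le_one]
  lt := by linarith [h.lt]
  le_one := by linarith [h.nonneg]
  left := by rw [isCovered_reflect]; simpa using h.right
  right := by rw [isCovered_reflect]; simpa using h.left
  covered x h1 h2 := isCovered_reflect.2 (h.covered _ (by linarith) (by linarith))

/-- The conjugate of an order automorphism of the line by the reflection `x ↦ 1 - x`. -/
def reflectIso (θ : ℝ ≃o ℝ) : ℝ ≃o ℝ where
  toFun x := 1 - θ (1 - x)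
  invFun x := 1 - θ.symm (1 - x)
  left_inv x := by simp
  right_inv x := by simp
  map_rel_iff' := by
    intro a b
    change 1 - θ (1 - a) ≤ 1 - θ (1 - b) ↔ a ≤ b
    rw [sub_le_sub_iff_left, θ.le_iff_le, sub_le_sub_iff_left]

theorem IsDetected.reflect {D : ℝ → ℝ → Prop} {M : Set (ℝ × ℝ)} (h : IsDetected (reflect D) M) :
    IsDetected D {e | (1 - e.2, 1 - e.1) ∈ M} := by
  obtain ⟨θ, ι, hι, α, β, γ, δ, h0, h1, hq, hinf, hfin⟩ := h
  refine ⟨reflectIso θ, ι, hι, fun i => 1 - δ i, fun i => 1 - γ i, fun i => 1 - β i,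
    fun i => 1 - α i, ?_, ?_, ?_, ?_, ?_⟩
  · simp [reflectIso, h1]
  · simp [reflectIso, h0]
  · intro i
    obtain ⟨g1, g2, g3, g4, g5⟩ := hq i
    refine ⟨?_, ?_, ?_, ?_, ?_⟩ <;> linarith
  · intro a b hab
    refine (hinf _ _ hab).mono fun i hi => ?_
    exact ⟨by linarith [hi.2], by linarith [hi.1]⟩
  · intro a b hab hab'
    refine (hfin (1 - b) (1 - a) (by simpa [NestAlgebra.reflect] using hab) ?_).subset fun i hi => ?_
    · have e : ∀ x, (reflectIso θ).symm x = 1 - θ.symm (1 - x) := fun x => rfl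
      simpa [NestAlgebra.reflect, e] using hab'
    · exact ⟨by linarith [hi.2], by linarith [hi.1]⟩

theorem IsDetectable.reflect {D : ℝ → ℝ → Prop} {M : Set (ℝ × ℝ)}
    (h : IsDetectable (reflect D) M) : IsDetectable D {e | (1 - e.2, 1 - e.1) ∈ M} := by
  induction h with
  | of h => exact .of h.reflect
  | union _ _ h₁ h₂ => exact h₁.union h₂
  | mono _ hs h₁ => exact h₁.mono fun e he => hs he

theorem IsDownset.exists_component {D : ℝ → ℝ → Prop} (hD : IsDownset D) {a b : ℝ} (h0 : 0 ≤ a)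
    (hab : a < b) (h1 : b ≤ 1) (hc : ∀ c, a < c → c < b → IsCovered D c) :
    ∃ u v, IsComponent D u v ∧ u ≤ a ∧ b ≤ v := by
  have hopen : IsOpen {x | IsCovered D x} := by
    have : {x | IsCovered D x} = ⋃ p ∈ {p : ℝ × ℝ | D p.1 p.2}, Ioo p.1 p.2 := by
      ext x
      simp only [IsCovered, mem_ofPred_eq, mem_iUnion, mem_Ioo, exists_prop, Prod.exists]
    rw [this]
    exact isOpen_biUnion fun _ _ => isOpen_Ioo
  have hclosed : IsClosed {x | ¬ IsCovered D x} := hopen.isClosed_compl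
  have n0 : ¬ IsCovered D 0 := fun ⟨x, y, h, h', _⟩ => absurd (hD.nonneg h) (not_le.2 h')
  have n1 : ¬ IsCovered D 1 := fun ⟨x, y, h, _, h'⟩ => absurd (hD.le_one h) (not_le.2 h')
  have hL : BddAbove ({x | ¬ IsCovered D x} ∩ Iic a) := ⟨a, fun x hx => hx.2⟩
  have hR : BddBelow ({x | ¬ IsCovered D x} ∩ Ici b) := ⟨b, fun x hx => hx.2⟩
  have hu := (hclosed.inter isClosed_Iic).csSup_mem ⟨0, n0, h0⟩ hL
  have hv := (hclosed.inter isClosed_Ici).csInf_mem ⟨1, n1, h1⟩ hR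
  refine ⟨_, _, ⟨le_csSup hL ⟨n0, h0⟩, (hu.2.trans_lt hab).trans_le hv.2, csInf_le hR ⟨n1, h1⟩,
    hu.1, hv.1, fun x hx hx' => ?_⟩, hu.2, hv.2⟩
  by_contra hx''
  rcases le_or_gt x a with h | h
  · exact absurd (le_csSup hL ⟨hx'', h⟩) (not_le.2 hx)
  rcases le_or_gt b x with h' | h'
  · exact absurd (csInf_le hR ⟨hx'', h'⟩) (not_le.2 hx')
  exact hx'' (hc x h h')

/-- The set of all intervals outside `D` is detectable. -/
theorem IsDownset.isDetectable_compl {D : ℝ → ℝ → Prop} (hD : IsDownset D) :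
    IsDetectable D {e | 0 ≤ e.1 ∧ e.1 < e.2 ∧ e.2 ≤ 1 ∧ ¬ D e.1 e.2} := by
  refine ((((IsDetectable.of (isDetected_crossing D)).union (isDetectable_component hD)).union
    (isDetectable_rightOutside hD)).union
    (isDetectable_rightOutside hD.reflect).reflect).mono ?_
  rintro ⟨a, b⟩ ⟨h0, hab, h1, hbad⟩
  dsimp only at *
  by_cases hc : ∃ c, a < c ∧ c < b ∧ ¬ IsCovered D c
  · obtain ⟨c, hac, hcb, hc⟩ := hc
    exact Or.inl (Or.inl (Or.inl ⟨c, h0.trans_lt hac, hcb.trans_le h1, hc, hac, hcb⟩))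
  push Not at hc
  obtain ⟨u, v, huv, hua, hbv⟩ := hD.exists_component h0 hab h1 hc
  have hmir : b < v → a + b ≤ u + v → (1 - b, 1 - a) ∈ rightOutside (NestAlgebra.reflect D) :=
    fun h h' => ⟨1 - v, 1 - u, huv.reflect, by dsimp only; linarith, by dsimp only; linarith,
      by dsimp only; linarith, by dsimp only; linarith, by simpa [NestAlgebra.reflect] using hbad⟩
  rcases hua.eq_or_lt with h | h
  · rcases hbv.eq_or_lt with h' | h'
    · subst h; subst h'
      exact Or.inl (Or.inl (Or.inr ⟨huv, hbad⟩))
    · exact Or.inr (hmir h' (by linarith))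
  · rcases le_total (u + v) (a + b) with h' | h'
    · exact Or.inl (Or.inr ⟨u, v, huv, h, hab, hbv, h', hbad⟩)
    · exact Or.inr (hmir (by linarith) h')

/-! ### Intervals of a nest -/

section Operators

variable {H : Type*} [NormedAddCommGroup H] [InnerProductSpace ℂ H] [CompleteSpace H]

theorem mul_eq_left_of_le {P Q : H →L[ℂ] H} (hP : IsStarProjection P) (hQ : IsStarProjection Q)
    (h : P ≤ Q) : P * Q = P := (hP.le_iff_mul_eq_left hQ).1 h

theorem mul_eq_right_of_le {P Q : H →L[ℂ] H} (hP : IsStarProjection P) (hQ : IsStarProjection Q)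
    (h : P ≤ Q) : Q * P = P := (hP.le_iff_mul_eq_right hQ).1 h

theorem isStarProjection_sub {P Q : H →L[ℂ] H} (hP : IsStarProjection P)
    (hQ : IsStarProjection Q) (h : P ≤ Q) : IsStarProjection (Q - P) := (hP.le_iff_sub hQ).1 h

theorem inner_apply_left {P : H →L[ℂ] H} (hP : IsStarProjection P) (x y : H) :
    inner ℂ (P x) y = inner ℂ x (P y) := by
  rw [← ContinuousLinearMap.adjoint_inner_left, ← ContinuousLinearMap.star_eq_adjoint,
    hP.isSelfAdjoint.star_eq]

theorem IsContinuousNest.commute {𝒩 : Set (H →L[ℂ] H)} (h𝒩 : IsContinuousNest 𝒩)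
    {M N : H →L[ℂ] H} (hM : M ∈ 𝒩) (hN : N ∈ 𝒩) : M * N = N * M := by
  have h1 := h𝒩.isStarProjection M hM
  have h2 := h𝒩.isStarProjection N hN
  rcases h𝒩.chain M hM N hN with h | h
  · rw [mul_eq_left_of_le h1 h2 h, mul_eq_right_of_le h1 h2 h]
  · rw [mul_eq_left_of_le h2 h1 h, mul_eq_right_of_le h2 h1 h]

theorem IsInterval.isStarProjection {𝒩 : Set (H →L[ℂ] H)} (h𝒩 : IsContinuousNest 𝒩)
    {E : H →L[ℂ] H} (hE : IsInterval 𝒩 E) : IsStarProjection E := by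
  obtain ⟨M, hM, N, hN, hle, rfl⟩ := hE
  exact isStarProjection_sub (h𝒩.isStarProjection M hM) (h𝒩.isStarProjection N hN) hle

/-- A nonzero interval lies below another one only if its ends lie between those of the other. -/
theorem IsContinuousNest.le_and_le_of_sub_le_sub {𝒩 : Set (H →L[ℂ] H)} (h𝒩 : IsContinuousNest 𝒩)
    {M N K L : H →L[ℂ] H} (hM : M ∈ 𝒩) (hN : N ∈ 𝒩) (hK : K ∈ 𝒩) (hL : L ∈ 𝒩) (hMN : M < N)
    (hKL : K ≤ L) (h : N - M ≤ L - K) : K ≤ M ∧ N ≤ L := by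
  have pM := h𝒩.isStarProjection M hM
  have pN := h𝒩.isStarProjection N hN
  have pK := h𝒩.isStarProjection K hK
  have pL := h𝒩.isStarProjection L hL
  have key : (N - M) * (L - K) = N - M := mul_eq_left_of_le (isStarProjection_sub pM pN hMN.le)
    (isStarProjection_sub pK pL hKL) h
  have e1 : K * (L - K) = 0 := by
    rw [mul_sub, mul_eq_left_of_le pK pL hKL, pK.isIdempotentElem.eq, sub_self]
  have e2 : L * (L - K) = L - K := by
    rw [mul_sub, mul_eq_right_of_le pK pL hKL, pL.isIdempotentElem.eq]
  have c1 : K * (N - M) = (N - M) * K := by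
    rw [mul_sub, sub_mul, h𝒩.commute hK hN, h𝒩.commute hK hM]
  have c2 : L * (N - M) = (N - M) * L := by
    rw [mul_sub, sub_mul, h𝒩.commute hL hN, h𝒩.commute hL hM]
  have k1 : K * N = K * M := by
    have : K * (N - M) = 0 := by
      rw [← key, ← mul_assoc, c1, mul_assoc, e1, mul_zero]
    rwa [mul_sub, sub_eq_zero] at this
  have k2 : L * N - L * M = N - M := by
    rw [← mul_sub]
    nth_rw 1 [← key]
    rw [← mul_assoc, c2, mul_assoc, e2, key]
  constructor
  · rcases h𝒩.chain K hK M hM with h' | h'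
    · exact h'
    · rw [mul_eq_right_of_le pM pK h'] at k1
      rcases h𝒩.chain K hK N hN with h'' | h''
      · rw [mul_eq_left_of_le pK pN h''] at k1
        exact k1.le
      · rw [mul_eq_right_of_le pN pK h''] at k1
        exact absurd k1 hMN.ne'
  · rcases h𝒩.chain N hN L hL with h' | h'
    · exact h'
    · rw [mul_eq_left_of_le pL pN h'] at k2
      rcases h𝒩.chain L hL M hM with h'' | h''
      · rw [mul_eq_left_of_le pL pM h'', sub_self] at k2
        exact absurd (sub_eq_zero.1 k2.symm) hMN.ne'
      · rw [mul_eq_right_of_le pM pL h''] at k2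
        exact (sub_left_injective k2).ge

/-- `F` is an order isomorphism, continuous for the strong operator topology, of `[0, 1]` onto the
nest `𝒩`; its values outside `[0, 1]` play no role. -/
structure IsUnitParametrization (𝒩 : Set (H →L[ℂ] H)) (F : ℝ → (H →L[ℂ] H)) : Prop where
  image_eq : F '' Icc 0 1 = 𝒩
  strictMonoOn : StrictMonoOn F (Icc 0 1)
  continuousOn : ∀ x, ContinuousOn (fun t => F t x) (Icc 0 1)

namespace IsUnitParametrization

variable {𝒩 : Set (H →L[ℂ] H)} {F : ℝ → (H →L[ℂ] H)}

theorem mem (hF : IsUnitParametrization 𝒩 F) {t : ℝ} (h0 : 0 ≤ t) (h1 : t ≤ 1) : F t ∈ 𝒩 :=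
  hF.image_eq ▸ ⟨t, ⟨h0, h1⟩, rfl⟩

theorem isInterval (hF : IsUnitParametrization 𝒩 F) {a b : ℝ} (h0 : 0 ≤ a) (hab : a ≤ b)
    (h1 : b ≤ 1) : IsInterval 𝒩 (F b - F a) :=
  ⟨F a, hF.mem h0 (hab.trans h1), F b, hF.mem (h0.trans hab) h1,
    hF.strictMonoOn.monotoneOn ⟨h0, hab.trans h1⟩ ⟨h0.trans hab, h1⟩ hab, rfl⟩

theorem exists_of_isInterval (hF : IsUnitParametrization 𝒩 F) {E : H →L[ℂ] H}
    (hE : IsInterval 𝒩 E) : ∃ a b, 0 ≤ a ∧ a ≤ b ∧ b ≤ 1 ∧ E = F b - F a := by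
  obtain ⟨M, hM, N, hN, hle, rfl⟩ := hE
  rw [← hF.image_eq] at hM hN
  obtain ⟨a, ha, rfl⟩ := hM
  obtain ⟨b, hb, rfl⟩ := hN
  exact ⟨a, b, ha.1, (hF.strictMonoOn.le_iff_le ha hb).1 hle, hb.2, rfl⟩

theorem apply_eq_self (hF : IsUnitParametrization 𝒩 F) (h𝒩 : IsContinuousNest 𝒩) {a b t : ℝ}
    (h0 : 0 ≤ a) (hab : a ≤ b) (hbt : b ≤ t) (h1 : t ≤ 1) {x : H} (hx : (F b - F a) x = x) :
    F t x = x := by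
  have p1 := h𝒩.isStarProjection _ (hF.mem h0 ((hab.trans hbt).trans h1))
  have p2 := h𝒩.isStarProjection _ (hF.mem (h0.trans hab) (hbt.trans h1))
  have p3 := h𝒩.isStarProjection _ (hF.mem ((h0.trans hab).trans hbt) h1)
  have hm := hF.strictMonoOn.monotoneOn
  have e : F t * (F b - F a) = F b - F a := by
    rw [mul_sub, mul_eq_right_of_le p2 p3 (hm ⟨h0.trans hab, hbt.trans h1⟩
      ⟨(h0.trans hab).trans hbt, h1⟩ hbt), mul_eq_right_of_le p1 p3 (hm ⟨h0, (hab.trans hbt).trans h1⟩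
      ⟨(h0.trans hab).trans hbt, h1⟩ (hab.trans hbt))]
  have := congrArg (fun T : H →L[ℂ] H => T x) e
  simp only [mul_apply_eq_comp, hx] at this
  exact this

theorem apply_eq_zero (hF : IsUnitParametrization 𝒩 F) (h𝒩 : IsContinuousNest 𝒩) {a b t : ℝ}
    (h0 : 0 ≤ t) (hta : t ≤ a) (hab : a ≤ b) (h1 : b ≤ 1) {x : H} (hx : (F b - F a) x = x) :
    F t x = 0 := by
  have p1 := h𝒩.isStarProjection _ (hF.mem (h0.trans hta) (hab.trans h1))
  have p2 := h𝒩.isStarProjection _ (hF.mem ((h0.trans hta).trans hab) h1)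
  have p3 := h𝒩.isStarProjection _ (hF.mem h0 ((hta.trans hab).trans h1))
  have hm := hF.strictMonoOn.monotoneOn
  have m1 : t ∈ Icc (0 : ℝ) 1 := ⟨h0, (hta.trans hab).trans h1⟩
  have m2 : a ∈ Icc (0 : ℝ) 1 := ⟨h0.trans hta, hab.trans h1⟩
  have m3 : b ∈ Icc (0 : ℝ) 1 := ⟨(h0.trans hta).trans hab, h1⟩
  have e : F t * (F b - F a) = 0 := by
    rw [mul_sub, mul_eq_left_of_le p3 p2 (hm m1 m3 (hta.trans hab)),
      mul_eq_left_of_le p3 p1 (hm m1 m2 hta), sub_self]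
  have := congrArg (fun T : H →L[ℂ] H => T x) e
  simp only [mul_apply_eq_comp, hx] at this
  simpa using this

theorem exists_ne_zero (hF : IsUnitParametrization 𝒩 F) (h𝒩 : IsContinuousNest 𝒩) {a b : ℝ}
    (h0 : 0 ≤ a) (hab : a < b) (h1 : b ≤ 1) : ∃ x : H, x ≠ 0 ∧ (F b - F a) x = x := by
  have hne : F b - F a ≠ 0 := sub_ne_zero.2
    (hF.strictMonoOn ⟨h0, hab.le.trans h1⟩ ⟨h0.trans hab.le, h1⟩ hab).ne'
  obtain ⟨y, hy⟩ := DFunLike.ne_iff.1 hne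
  refine ⟨(F b - F a) y, hy, ?_⟩
  have := ((hF.isInterval h0 hab.le h1).isStarProjection h𝒩).isIdempotentElem.eq
  exact congrArg (fun T : H →L[ℂ] H => T y) this

/-- The range of a nonzero interval of a continuous nest is infinite-dimensional: it contains a unit
vector orthogonal to any given finite set. -/
theorem exists_unit_orthogonal (hF : IsUnitParametrization 𝒩 F) (h𝒩 : IsContinuousNest 𝒩)
    {a b : ℝ} (h0 : 0 ≤ a) (hab : a < b) (h1 : b ≤ 1) (s : Finset H) :
    ∃ e : H, (F b - F a) e = e ∧ ‖e‖ = 1 ∧ ∀ x ∈ s, inner ℂ x e = 0 := by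
  obtain ⟨t, ht, htm, -⟩ := exists_seq_strictMono_tendsto' hab
  have hlt : ∀ n, t n < t (n + 1) := fun n => ht (Nat.lt_succ_self n)
  have ht0 : ∀ n, 0 ≤ t n := fun n => h0.trans (htm n).1.le
  have ht1 : ∀ n, t n ≤ 1 := fun n => (htm n).2.le.trans h1
  have hv := fun n => hF.exists_ne_zero h𝒩 (ht0 n) (hlt n) (ht1 (n + 1))
  choose v hv0 hv using hv
  have horth : ∀ i j, i < j → inner ℂ (v i) (v j) = 0 := by
    intro i j hij
    rw [← hF.apply_eq_self h𝒩 (ht0 i) (hlt i).le le_rfl (ht1 (i + 1)) (hv i),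
      inner_apply_left (h𝒩.isStarProjection _ (hF.mem (ht0 (i + 1)) (ht1 (i + 1)))),
      hF.apply_eq_zero h𝒩 (ht0 (i + 1)) (ht.monotone hij) (hlt j).le (ht1 (j + 1)) (hv j),
      inner_zero_right]
  have hli : LinearIndependent ℂ fun i : Fin (s.card + 1) => v i := by
    refine linearIndependent_of_ne_zero_of_inner_eq_zero (fun i => hv0 i) fun i j hij => ?_
    rcases lt_or_gt_of_ne hij with h | h
    · exact horth i j h
    · exact inner_eq_zero_symm.1 (horth j i h)
  let T : (Fin (s.card + 1) → ℂ) →ₗ[ℂ] (s → ℂ) :=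
    (LinearMap.pi fun x : s => (innerSL ℂ (x : H)).toLinearMap) ∘ₗ
      Fintype.linearCombination ℂ fun i : Fin (s.card + 1) => v i
  have hker : LinearMap.ker T ≠ ⊥ := LinearMap.ker_ne_bot_of_finrank_lt (by simp)
  obtain ⟨c, hc, hc0⟩ := Submodule.exists_mem_ne_zero_of_ne_bot hker
  let w : H := Fintype.linearCombination ℂ (fun i : Fin (s.card + 1) => v i) c
  have hw0 : w ≠ 0 := fun h => hc0 (by
    have := Fintype.linearIndependent_iff.1 hli c (by
      simpa [w, Fintype.linearCombination_apply] using h)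
    exact funext this)
  have hwE : (F b - F a) w = w := by
    simp only [w, Fintype.linearCombination_apply, map_sum, map_smul]
    refine Finset.sum_congr rfl fun i _ => ?_
    congr 1
    rw [sub_apply, hF.apply_eq_self h𝒩 (ht0 i) (hlt i).le (htm (i + 1)).2.le h1
      (hv i), hF.apply_eq_zero h𝒩 h0 (htm i).1.le (hlt i).le (ht1 (i + 1)) (hv i), sub_zero]
  have hws : ∀ x ∈ s, inner ℂ x w = 0 := fun x hx => congrFun (LinearMap.mem_ker.1 hc) ⟨x, hx⟩
  refine ⟨((‖w‖⁻¹ : ℝ) : ℂ) • w, by rw [map_smul, hwE], ?_, fun x hx => ?_⟩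
  · rw [norm_smul, Complex.norm_real, norm_inv, norm_norm, inv_mul_cancel₀ (norm_ne_zero_iff.2 hw0)]
  · rw [inner_smul_right, hws x hx, mul_zero]

end IsUnitParametrization

open Classical in
/-- Unit vectors with prescribed properties can be assembled into an orthonormal sequence as soon as
each property can be met orthogonally to any finite set. -/
theorem exists_orthonormal_seq (P : ℕ → H → Prop)
    (h : ∀ n (s : Finset H), ∃ e, P n e ∧ ‖e‖ = 1 ∧ ∀ x ∈ s, inner ℂ x e = 0) :
    ∃ e : ℕ → H, Orthonormal ℂ e ∧ ∀ n, P n (e n) := by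
  choose nxt h1 h2 h3 using h
  let L : ℕ → Finset H := fun n => Nat.rec ∅ (fun n s => insert (nxt n s) s) n
  have hL : ∀ n, L (n + 1) = insert (nxt n (L n)) (L n) := fun n => rfl
  have hmem : ∀ m n, m < n → nxt m (L m) ∈ L n := by
    intro m n hmn
    induction n, hmn using Nat.le_induction with
    | base => rw [hL]; exact Finset.mem_insert_self _ _
    | succ n _ ih => rw [hL]; exact Finset.mem_insert_of_mem ih
  refine ⟨fun n => nxt n (L n), ⟨fun n => h2 _ _, fun m n hmn => ?_⟩, fun n => h1 _ _⟩
  rcases lt_or_gt_of_ne hmn with h | h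
  · exact h3 _ _ _ (hmem m n h)
  · exact inner_eq_zero_symm.1 (h3 _ _ _ (hmem n m h))

theorem IsUnitParametrization.exists_orthonormal {𝒩 : Set (H →L[ℂ] H)} {F : ℝ → (H →L[ℂ] H)}
    (hF : IsUnitParametrization 𝒩 F) (h𝒩 : IsContinuousNest 𝒩) {ι : Type*} [Countable ι]
    (a b : ι → ℝ) (h0 : ∀ i, 0 ≤ a i) (hab : ∀ i, a i < b i) (h1 : ∀ i, b i ≤ 1) :
    ∃ e : ι → H, Orthonormal ℂ e ∧ ∀ i, (F (b i) - F (a i)) (e i) = e i := by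
  obtain ⟨c, hc⟩ := exists_injective_nat ι
  obtain ⟨e, he, he'⟩ := exists_orthonormal_seq
    (fun n x => ∀ i, c i = n → (F (b i) - F (a i)) x = x) (by
      intro n s
      by_cases hn : ∃ i, c i = n
      · obtain ⟨i, rfl⟩ := hn
        obtain ⟨e, h⟩ := hF.exists_unit_orthogonal h𝒩 (h0 i) (hab i) (h1 i) s
        exact ⟨e, fun j hj => hc hj ▸ h.1, h.2⟩
      · obtain ⟨e, h⟩ := hF.exists_unit_orthogonal h𝒩 le_rfl zero_lt_one le_rfl s
        exact ⟨e, fun j hj => absurd ⟨j, hj⟩ hn, h.2⟩)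
  exact ⟨e ∘ c, he.comp c hc, fun i => he' _ i rfl⟩

/-! ### Sums of rank-one operators -/

/-- The partial isometry which maps one orthonormal family to another. -/
theorem exists_partialIsometry {ι : Type*} {e f : ι → H} (he : Orthonormal ℂ e)
    (hf : Orthonormal ℂ f) : ∃ X : H →L[ℂ] H, (∀ i, X (f i) = e i) ∧
      ∀ x y, HasSum (fun i => inner ℂ y (e i) * inner ℂ (f i) x) (inner ℂ y (X x)) := by
  classical
  let V := he.orthogonalFamily.linearIsometry
  let W := hf.orthogonalFamily.linearIsometry
  let V' := V.toContinuousLinearMap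
  let W' := W.toContinuousLinearMap
  have hV : ∀ i, V (lp.single 2 i (1 : ℂ)) = e i := fun i => by
    simp [V, OrthogonalFamily.linearIsometry_apply_single]
  have hW : ∀ i, W (lp.single 2 i (1 : ℂ)) = f i := fun i => by
    simp [W, OrthogonalFamily.linearIsometry_apply_single]
  have cV : ∀ y i, (ContinuousLinearMap.adjoint V' y) i = inner ℂ (e i) y := by
    intro y i
    have := lp.inner_single_left (𝕜 := ℂ) i (1 : ℂ) (ContinuousLinearMap.adjoint V' y)
    rw [ContinuousLinearMap.adjoint_inner_right] at this
    rw [← hV i]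
    simpa [V'] using this.symm
  have cW : ∀ y i, (ContinuousLinearMap.adjoint W' y) i = inner ℂ (f i) y := by
    intro y i
    have := lp.inner_single_left (𝕜 := ℂ) i (1 : ℂ) (ContinuousLinearMap.adjoint W' y)
    rw [ContinuousLinearMap.adjoint_inner_right] at this
    rw [← hW i]
    simpa [W'] using this.symm
  have hsum : ∀ x y, HasSum (fun i => inner ℂ y (e i) * inner ℂ (f i) x)
      (inner ℂ y (V' (ContinuousLinearMap.adjoint W' x))) := by
    intro x y
    rw [← ContinuousLinearMap.adjoint_inner_left]
    have := lp.hasSum_inner (𝕜 := ℂ) (ContinuousLinearMap.adjoint V' y)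
      (ContinuousLinearMap.adjoint W' x)
    simp only [cV, cW, RCLike.inner_apply, inner_conj_symm] at this
    simpa [mul_comm] using this
  refine ⟨V' ∘L ContinuousLinearMap.adjoint W', fun i => ?_, hsum⟩
  refine ext_inner_left ℂ fun y => ((hsum (f i) y).unique ?_)
  have : inner ℂ y (e i) = inner ℂ y (e i) * inner ℂ (f i) (f i) := by
    rw [inner_self_eq_norm_sq_to_K, hf.1 i]; simp
  rw [this]
  refine hasSum_single i fun j hj => ?_
  rw [hf.2 hj, mul_zero]

theorem isCompactOperator_rankOne (x y : H) :
    IsCompactOperator (InnerProductSpace.rankOne ℂ x y) := by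
  have h : IsCompactOperator (innerSL ℂ y : H →L[ℂ] ℂ) :=
    isCompactOperator_of_locallyCompactSpace_dom _
  exact h.clm_comp (ContinuousLinearMap.toSpanSingleton ℂ x)

theorem isCompactOperator_sum {ι : Type*} (s : Finset ι) (T : ι → H →L[ℂ] H)
    (h : ∀ i ∈ s, IsCompactOperator (T i)) : IsCompactOperator (∑ i ∈ s, T i : H →L[ℂ] H) := by
  classical
  induction s using Finset.induction_on with
  | empty => simpa using isCompactOperator_zero
  | insert i s hi ih =>
    rw [Finset.sum_insert hi]
    exact (h i (Finset.mem_insert_self _ _)).add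
      (ih fun j hj => h j (Finset.mem_insert_of_mem hj))

theorem isCompactOperator_compression {ι : Type*} {e f : ι → H} {X E : H →L[ℂ] H}
    (hX : ∀ x y, HasSum (fun i => inner ℂ y (e i) * inner ℂ (f i) x) (inner ℂ y (X x)))
    (hE : IsStarProjection E) (hfin : {i | E (e i) ≠ 0 ∧ E (f i) ≠ 0}.Finite) :
    IsCompactOperator (E * X * E) := by
  have : E * X * E = ∑ i ∈ hfin.toFinset, InnerProductSpace.rankOne ℂ (E (e i)) (E (f i)) := by
    ext x
    refine ext_inner_left ℂ fun y => ?_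
    have h1 := hX (E x) (E y)
    rw [inner_apply_left hE] at h1
    refine h1.unique ?_
    simp only [sum_apply, InnerProductSpace.rankOne_apply, inner_sum,
      inner_smul_right]
    have h2 : ∀ i, inner ℂ (E y) (e i) * inner ℂ (f i) (E x) =
        inner ℂ (E (f i)) x * inner ℂ y (E (e i)) := fun i => by
      rw [inner_apply_left hE, inner_apply_left hE, mul_comm]
    simp only [h2]
    refine hasSum_sum_of_ne_finset_zero fun i hi => ?_
    simp only [Finite.mem_toFinset, mem_ofPred_eq, not_and_or, not_not] at hi
    rcases hi with hi | hi <;> simp [hi]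
  rw [this]
  exact isCompactOperator_sum _ _ fun i _ => isCompactOperator_rankOne _ _

/-! ### The essential norm -/

theorem essNorm_lt_iff {X : H →L[ℂ] H} {ε : ℝ} :
    essNorm X < ε ↔ ∃ K : H →L[ℂ] H, IsCompactOperator K ∧ ‖X - K‖ < ε := by
  rw [essNorm, Metric.infDist_lt_iff ⟨0, isCompactOperator_zero⟩]
  simp only [dist_eq_norm, mem_ofPred_eq]

theorem essNorm_nonneg (X : H →L[ℂ] H) : 0 ≤ essNorm X := Metric.infDist_nonneg

theorem essNorm_le_norm (X : H →L[ℂ] H) : essNorm X ≤ ‖X‖ := by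
  have := Metric.infDist_le_dist_of_mem (x := X)
    (show (0 : H →L[ℂ] H) ∈ {K : H →L[ℂ] H | IsCompactOperator K} from isCompactOperator_zero)
  simpa [essNorm, dist_eq_norm] using this

theorem essNorm_eq_zero_of_isCompactOperator {X : H →L[ℂ] H} (hX : IsCompactOperator X) :
    essNorm X = 0 := Metric.infDist_zero_of_mem hX

theorem norm_compression_le {E : H →L[ℂ] H} (hE : IsStarProjection E) (X : H →L[ℂ] H) :
    ‖E * X * E‖ ≤ ‖X‖ := by
  have h := IsStarProjection.norm_le E hE
  calc ‖E * X * E‖ ≤ ‖E‖ * ‖X‖ * ‖E‖ := (norm_mul_le _ _).trans (by gcongr; exact norm_mul_le _ _)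
    _ ≤ 1 * ‖X‖ * 1 := by gcongr
    _ = ‖X‖ := by ring

theorem essNorm_compression_mono {E F : H →L[ℂ] H} (hE : IsStarProjection E)
    (hF : IsStarProjection F) (h : E ≤ F) (X : H →L[ℂ] H) :
    essNorm (E * X * E) ≤ essNorm (F * X * F) := by
  refine le_of_forall_gt fun ε hε => ?_
  obtain ⟨K, hK, hlt⟩ := essNorm_lt_iff.1 hε
  refine essNorm_lt_iff.2 ⟨E * K * E, (hK.clm_comp E).comp_clm E, ?_⟩
  have h1 := mul_eq_left_of_le hE hF h
  have h2 := mul_eq_right_of_le hE hF h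
  have : E * X * E - E * K * E = E * (F * X * F - K) * E := by
    rw [mul_sub, sub_mul]
    congr 1
    rw [← mul_assoc, ← mul_assoc, h1, mul_assoc (E * X), h2]
  rw [this]
  exact (norm_compression_le hE _).trans_lt hlt

/-- An operator that maps an infinite orthonormal family to an orthonormal one has essential norm at
least `1`, since a compact operator brings two members of the family arbitrarily close together. -/
theorem one_le_essNorm {ι : Type*} {e f : ι → H} (he : Orthonormal ℂ e) (hf : Orthonormal ℂ f)
    {T : H →L[ℂ] H} {s : Set ι} (hs : s.Infinite) (hT : ∀ i ∈ s, T (f i) = e i) :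
    1 ≤ essNorm T := by
  by_contra hc
  obtain ⟨K, hK, hlt⟩ := essNorm_lt_iff.1 (not_le.1 hc)
  have hdist : ∀ {g : ι → H}, Orthonormal ℂ g → ∀ i j, i ≠ j → ‖g i - g j‖ = √2 := by
    intro g hg i j hij
    rw [← Real.sqrt_sq (norm_nonneg (g i - g j)), @norm_sub_sq ℂ, hg.2 hij, hg.1, hg.1]
    norm_num
  have hpos : 0 < √2 * (1 - ‖T - K‖) := by
    have := sub_pos.2 hlt
    positivity
  obtain ⟨C, hC, hsub⟩ := hK.image_closedBall_subset_compact (f := K.toLinearMap) 1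
  obtain ⟨t, -, htf, hcov⟩ := hC.finite_cover_balls (half_pos hpos)
  have hch : ∀ i ∈ s, ∃ y ∈ t, dist (K (f i)) y < √2 * (1 - ‖T - K‖) / 2 := by
    intro i _
    have := hcov (hsub ⟨f i, by simp [hf.1 i], rfl⟩)
    simpa using this
  choose! y hy hy' using hch
  obtain ⟨i, hi, j, hj, hij, hyy⟩ := hs.exists_ne_map_eq_of_mapsTo hy htf
  have h1 : ‖K (f i) - K (f j)‖ < √2 * (1 - ‖T - K‖) := by
    rw [← dist_eq_norm]
    have a1 := hy' i hi
    have a2 := hy' j hj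
    rw [← hyy] at a2
    linarith [dist_triangle_right (K (f i)) (K (f j)) (y i)]
  have h2 : ‖(T - K) (f i - f j)‖ ≤ ‖T - K‖ * √2 := by
    rw [← hdist hf i j hij]; exact ContinuousLinearMap.le_opNorm _ _
  have h3 : e i - e j = (T - K) (f i - f j) + (K (f i) - K (f j)) := by
    simp only [sub_apply, map_sub, hT i hi, hT j hj]
    abel
  have h4 := hdist he i j hij
  rw [h3] at h4
  have := norm_add_le ((T - K) (f i - f j)) (K (f i) - K (f j))
  linarith

end Operators

/-! ### Parametrization of a continuous nest -/

section Parametrization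

variable {H : Type*} [NormedAddCommGroup H] [InnerProductSpace ℂ H] [CompleteSpace H]

theorem norm_sq_add_of_le {P Q : H →L[ℂ] H} (hP : IsStarProjection P) (hQ : IsStarProjection Q)
    (h : P ≤ Q) (x : H) : ‖Q x‖ ^ 2 = ‖P x‖ ^ 2 + ‖(Q - P) x‖ ^ 2 := by
  have h1 : Q x = P x + (Q - P) x := by rw [sub_apply]; abel
  have h2 : inner ℂ (P x) ((Q - P) x) = 0 := by
    rw [inner_apply_left hP, ← mul_apply_eq_comp, mul_sub, mul_eq_left_of_le hP hQ h,
      hP.isIdempotentElem.eq, sub_self, zero_apply, inner_zero_right]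
  have := norm_add_sq_eq_norm_sq_add_norm_sq_of_inner_eq_zero _ _ h2
  rw [h1]
  simp only [sq]
  exact this

theorem norm_apply_le {P : H →L[ℂ] H} (hP : IsStarProjection P) (x : H) : ‖P x‖ ≤ ‖x‖ :=
  (P.le_opNorm x).trans (mul_le_of_le_one_left (norm_nonneg _) (IsStarProjection.norm_le P hP))

theorem starProjection_congr {K L : Submodule ℂ H} [K.HasOrthogonalProjection]
    [L.HasOrthogonalProjection] (h : K = L) : K.starProjection = L.starProjection := by
  subst h; rfl

theorem tendsto_apply_of_range_eq_iSup {ι : Type*} [Preorder ι] {P : ι → H →L[ℂ] H}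
    {Q : H →L[ℂ] H} (hP : ∀ i, IsStarProjection (P i)) (hQ : IsStarProjection Q) (hm : Monotone P)
    (h : LinearMap.range Q.toLinearMap =
      (⨆ i, LinearMap.range (P i).toLinearMap).topologicalClosure) (x : H) :
    Filter.Tendsto (fun i => P i x) Filter.atTop (𝓝 (Q x)) := by
  have hP' := fun i => isStarProjection_iff_eq_starProjection_range.1 (hP i)
  obtain ⟨_, hQ'⟩ := isStarProjection_iff_eq_starProjection_range.1 hQ
  have := fun i => (hP' i).choose
  have e : ∀ i, P i = (LinearMap.range (P i).toLinearMap).starProjection :=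
    fun i => (hP' i).choose_spec
  have := Submodule.starProjection_tendsto_closure_iSup
    (fun i => LinearMap.range (P i).toLinearMap) (fun i j hij => by
      have := hm hij
      rw [e i, e j] at this
      exact Submodule.starProjection_le_starProjection_iff.1 this) x
  rw [← starProjection_congr h, ← hQ'] at this
  refine this.congr fun i => ?_
  rw [← e i]

theorem range_one_sub {P : H →L[ℂ] H} (hP : IsStarProjection P) :
    LinearMap.range (1 - P).toLinearMap = (LinearMap.range P.toLinearMap)ᗮ := by
  obtain ⟨_, e⟩ := isStarProjection_iff_eq_starProjection_range.1 hP
  have : 1 - P = ((LinearMap.range P.toLinearMap)ᗮ).starProjection := by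
    rw [Submodule.starProjection_orthogonal', ← e]
  rw [this]
  exact Submodule.range_starProjection _

theorem range_closed {P : H →L[ℂ] H} (hP : IsStarProjection P) :
    (LinearMap.range P.toLinearMap)ᗮᗮ = LinearMap.range P.toLinearMap := by
  obtain ⟨_, -⟩ := isStarProjection_iff_eq_starProjection_range.1 hP
  exact Submodule.orthogonal_orthogonal _

theorem le_of_range_le {P Q : H →L[ℂ] H} (hP : IsStarProjection P) (hQ : IsStarProjection Q)
    (h : LinearMap.range P.toLinearMap ≤ LinearMap.range Q.toLinearMap) : P ≤ Q := by
  obtain ⟨_, e⟩ := isStarProjection_iff_eq_starProjection_range.1 hP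
  obtain ⟨_, e'⟩ := isStarProjection_iff_eq_starProjection_range.1 hQ
  rw [e, e']
  exact Submodule.starProjection_le_starProjection_iff.2 h

theorem tendsto_one_sub_apply_of_range_eq_iInf {ι : Type*} [Preorder ι] {P : ι → H →L[ℂ] H}
    {Q : H →L[ℂ] H} (hP : ∀ i, IsStarProjection (P i)) (hQ : IsStarProjection Q) (hm : Antitone P)
    (h : LinearMap.range Q.toLinearMap = ⨅ i, LinearMap.range (P i).toLinearMap) (x : H) :
    Filter.Tendsto (fun i => (1 - P i) x) Filter.atTop (𝓝 ((1 - Q) x)) := by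
  refine tendsto_apply_of_range_eq_iSup (fun i => (hP i).one_sub) hQ.one_sub
    (fun i j hij => sub_le_sub_left (hm hij) 1) ?_ x
  rw [← Submodule.orthogonal_orthogonal_eq_closure, ← Submodule.iInf_orthogonal, range_one_sub hQ,
    h]
  congr 1
  refine iInf_congr fun i => ?_
  rw [range_one_sub (hP i), range_closed (hP i)]

variable [TopologicalSpace.SeparableSpace H]

/-- Positive weights which make `∑ n, nestWeight n * ‖u n‖ ^ 2` converge for the dense sequence `u`
of the Hilbert space. -/
def nestWeight (H : Type*) [NormedAddCommGroup H] [TopologicalSpace.SeparableSpace H] (n : ℕ) : ℝ :=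
  (1 / 2) ^ n / (1 + ‖TopologicalSpace.denseSeq H n‖ ^ 2)

/-- The weighted sum of the `‖T u‖ ^ 2`, for `u` in a dense sequence. Restricted to a nest, it is
strictly increasing and continuous. -/
def nestSize (T : H →L[ℂ] H) : ℝ :=
  ∑' n, nestWeight H n * ‖T (TopologicalSpace.denseSeq H n)‖ ^ 2

theorem nestWeight_pos (n : ℕ) : 0 < nestWeight H n := by
  unfold nestWeight; positivity

theorem nestSize_summable {P : H →L[ℂ] H} (hP : IsStarProjection P) :
    Summable fun n => nestWeight H n * ‖P (TopologicalSpace.denseSeq H n)‖ ^ 2 := by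
  refine Summable.of_nonneg_of_le (fun n => by have := nestWeight_pos (H := H) n; positivity)
    (fun n => ?_) (summable_geometric_of_lt_one (r := (1 / 2 : ℝ)) (by norm_num) (by norm_num))
  rw [nestWeight, div_mul_eq_mul_div, div_le_iff₀ (by positivity)]
  refine mul_le_mul_of_nonneg_left ?_ (by positivity)
  have := pow_le_pow_left₀ (norm_nonneg _) (norm_apply_le hP (TopologicalSpace.denseSeq H n)) 2
  linarith

theorem nestSize_nonneg (T : H →L[ℂ] H) : 0 ≤ nestSize T :=
  tsum_nonneg fun n => by have := nestWeight_pos (H := H) n; positivity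

theorem nestSize_add {P Q : H →L[ℂ] H} (hP : IsStarProjection P) (hQ : IsStarProjection Q)
    (h : P ≤ Q) : nestSize Q = nestSize P + nestSize (Q - P) := by
  rw [nestSize, nestSize, nestSize, ← (nestSize_summable hP).tsum_add
    (nestSize_summable (isStarProjection_sub hP hQ h))]
  refine tsum_congr fun n => ?_
  rw [norm_sq_add_of_le hP hQ h, mul_add]

theorem le_nestSize {P : H →L[ℂ] H} (hP : IsStarProjection P) (n : ℕ) :
    nestWeight H n * ‖P (TopologicalSpace.denseSeq H n)‖ ^ 2 ≤ nestSize P :=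
  (nestSize_summable hP).le_tsum n fun m _ => by
    have := nestWeight_pos (H := H) m; positivity

theorem nestSize_lt {P Q : H →L[ℂ] H} (hP : IsStarProjection P) (hQ : IsStarProjection Q)
    (h : P < Q) : nestSize P < nestSize Q := by
  rw [nestSize_add hP hQ h.le, lt_add_iff_pos_right]
  refine lt_of_le_of_ne (nestSize_nonneg _) fun h0 => h.ne' (sub_eq_zero.1 ?_)
  have hz : ∀ n, (Q - P) (TopologicalSpace.denseSeq H n) = 0 := by
    intro n
    have h1 := le_nestSize (isStarProjection_sub hP hQ h.le) n
    rw [← h0] at h1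
    have h2 := nestWeight_pos (H := H) n
    have h3 : ‖(Q - P) (TopologicalSpace.denseSeq H n)‖ ^ 2 ≤ 0 := by
      by_contra hc
      have := mul_pos h2 (not_le.1 hc)
      linarith
    exact norm_eq_zero.1 (pow_eq_zero_iff two_ne_zero |>.1 (le_antisymm h3 (by positivity)))
  refine ContinuousLinearMap.ext fun x => ?_
  have := ((Q - P).continuous.ext_on (g := fun _ => (0 : H))
    (TopologicalSpace.denseRange_denseSeq H) continuous_const (by rintro _ ⟨n, rfl⟩; exact hz n))
  exact congrFun this x

/-- Lower semicontinuity of `nestSize` for the strong operator topology. -/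
theorem nestSize_le_of_tendsto {ι : Type*} {l : Filter ι} [l.NeBot] {P : ι → H →L[ℂ] H}
    {Q : H →L[ℂ] H} (hP : ∀ i, IsStarProjection (P i))
    (h : ∀ x, Filter.Tendsto (fun i => P i x) l (𝓝 (Q x))) {c : ℝ} (hc : ∀ i, nestSize (P i) ≤ c) :
    nestSize Q ≤ c := by
  refine Real.tsum_le_of_sum_range_le
    (fun n => by have := nestWeight_pos (H := H) n; positivity) fun K => ?_
  have ht : Filter.Tendsto (fun i => ∑ n ∈ Finset.range K,
      nestWeight H n * ‖P i (TopologicalSpace.denseSeq H n)‖ ^ 2) l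
      (𝓝 (∑ n ∈ Finset.range K, nestWeight H n * ‖Q (TopologicalSpace.denseSeq H n)‖ ^ 2)) :=
    tendsto_finsetSum _ fun n _ => ((h _).norm.pow 2).const_mul _
  refine le_of_tendsto ht (Filter.Eventually.of_forall fun i => le_trans ?_ (hc i))
  exact (nestSize_summable (hP i)).sum_le_tsum _ fun n _ => by
    have := nestWeight_pos (H := H) n; positivity

/-- Every value between `0` and `nestSize 1` is attained on a continuous nest: at the infimum of the
members of the nest at which it is reached or exceeded. -/
theorem IsContinuousNest.exists_nestSize_eq {𝒩 : Set (H →L[ℂ] H)} (h𝒩 : IsContinuousNest 𝒩)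
    {t : ℝ} (h0 : 0 ≤ t) (h1 : t ≤ nestSize (1 : H →L[ℂ] H)) : ∃ N ∈ 𝒩, nestSize N = t := by
  let S : Set (H →L[ℂ] H) := {M | M ∈ 𝒩 ∧ t ≤ nestSize M}
  obtain ⟨N, hN, hrange⟩ := h𝒩.inf_mem S fun M hM => hM.1
  have pN := h𝒩.isStarProjection N hN
  rw [iInf_subtype'] at hrange
  have hmin : ∀ M ∈ S, N ≤ M := fun M hM => le_of_range_le pN (h𝒩.isStarProjection M hM.1) (by
    rw [hrange]; exact iInf_le (fun M : S => LinearMap.range (M : H →L[ℂ] H).toLinearMap) ⟨M, hM⟩)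
  refine ⟨N, hN, le_antisymm ?_ ?_⟩
  · by_cases hN0 : N = 0
    · rw [hN0]; simpa [nestSize] using h0
    let T : Set (H →L[ℂ] H) := {M | M ∈ 𝒩 ∧ M < N}
    have hT : Nonempty T := ⟨0, h𝒩.zero_mem, lt_of_le_of_ne pN.nonneg (Ne.symm hN0)⟩
    have hdir : IsDirectedOrder T := ⟨fun A B => by
      rcases h𝒩.chain A A.2.1 B B.2.1 with h | h
      · exact ⟨B, h, le_rfl⟩
      · exact ⟨A, le_rfl, h⟩⟩
    have hsup := h𝒩.continuous N hN
    rw [iSup_subtype'] at hsup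
    have hT' : ∀ M : T, nestSize (M : H →L[ℂ] H) ≤ t := by
      rintro ⟨M, hM, hMN⟩
      by_contra hc
      exact absurd (hmin M ⟨hM, (not_le.1 hc).le⟩) hMN.not_ge
    have pT : ∀ M : T, IsStarProjection (M : H →L[ℂ] H) := fun M => h𝒩.isStarProjection M M.2.1
    have htend : ∀ x, Filter.Tendsto (fun M : T => (M : H →L[ℂ] H) x) Filter.atTop (𝓝 (N x)) :=
      tendsto_apply_of_range_eq_iSup (P := fun M : T => (M : H →L[ℂ] H)) pT pN (fun A B h => h) hsup
    exact nestSize_le_of_tendsto pT htend hT'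
  · have hS : Nonempty Sᵒᵈ := ⟨OrderDual.toDual ⟨1, h𝒩.one_mem, h1⟩⟩
    have hdir : IsDirectedOrder Sᵒᵈ := ⟨fun A B => by
      rcases h𝒩.chain (OrderDual.ofDual A : S).1 (OrderDual.ofDual A : S).2.1
        (OrderDual.ofDual B : S).1 (OrderDual.ofDual B : S).2.1 with h | h
      · exact ⟨A, le_rfl, h⟩
      · exact ⟨B, h, le_rfl⟩⟩
    have pS : ∀ M : S, IsStarProjection (M : H →L[ℂ] H) := fun M => h𝒩.isStarProjection M M.2.1
    have hadd : ∀ {P : H →L[ℂ] H}, IsStarProjection P →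
        nestSize (1 : H →L[ℂ] H) = nestSize P + nestSize (1 - P) := fun hP =>
      nestSize_add hP (.one _) hP.le_one
    have key : nestSize (1 - N) ≤ nestSize (1 : H →L[ℂ] H) - t := by
      refine nestSize_le_of_tendsto (ι := Sᵒᵈ)
        (P := fun M => 1 - ((OrderDual.ofDual M : S) : H →L[ℂ] H)) (l := Filter.atTop)
        (fun M => (pS _).one_sub)
        (tendsto_one_sub_apply_of_range_eq_iInf (ι := Sᵒᵈ)
          (P := fun M => ((OrderDual.ofDual M : S) : H →L[ℂ] H)) (fun M => pS _) pN
          (fun A B h => h) hrange) fun M => ?_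
      have := hadd (pS (OrderDual.ofDual M))
      linarith [(OrderDual.ofDual M).2.2]
    linarith [hadd pN]

theorem IsContinuousNest.exists_unitParametrization [Nontrivial H] {𝒩 : Set (H →L[ℂ] H)}
    (h𝒩 : IsContinuousNest 𝒩) : ∃ F, IsUnitParametrization 𝒩 F := by
  have hlt : ∀ M ∈ 𝒩, ∀ N ∈ 𝒩, nestSize M < nestSize N ↔ M < N := by
    intro M hM N hN
    refine ⟨fun h => ?_, nestSize_lt (h𝒩.isStarProjection M hM) (h𝒩.isStarProjection N hN)⟩
    rcases h𝒩.chain M hM N hN with h' | h'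
    · exact lt_of_le_of_ne h' fun e => by rw [e] at h; exact lt_irrefl _ h
    · rcases h'.eq_or_lt with e | h''
      · rw [e] at h; exact absurd h (lt_irrefl _)
      · exact absurd (nestSize_lt (h𝒩.isStarProjection N hN) (h𝒩.isStarProjection M hM) h'')
          h.not_gt
  have hinj : ∀ M ∈ 𝒩, ∀ N ∈ 𝒩, nestSize M = nestSize N → M = N := by
    intro M hM N hN h
    by_contra hne
    rcases h𝒩.chain M hM N hN with h' | h'
    · exact h.not_lt ((hlt M hM N hN).2 (lt_of_le_of_ne h' hne))
    · exact h.not_gt ((hlt N hN M hM).2 (lt_of_le_of_ne h' (Ne.symm hne)))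
  have hz : nestSize (0 : H →L[ℂ] H) = 0 := by simp [nestSize]
  have hle1 : ∀ N ∈ 𝒩, nestSize N ≤ nestSize (1 : H →L[ℂ] H) := by
    intro N hN
    have hp := h𝒩.isStarProjection N hN
    rw [nestSize_add hp (.one _) hp.le_one]
    linarith [nestSize_nonneg (1 - N)]
  set c := nestSize (1 : H →L[ℂ] H) with hc
  have hcpos : 0 < c := by
    rw [← hz]
    exact (hlt 0 h𝒩.zero_mem 1 h𝒩.one_mem).2
      (lt_of_le_of_ne (IsStarProjection.one (H →L[ℂ] H)).nonneg zero_ne_one)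
  have hex : ∀ t : ℝ, ∃ N : H →L[ℂ] H, t ∈ Icc (0 : ℝ) 1 → N ∈ 𝒩 ∧ nestSize N = c * t := by
    intro t
    by_cases ht : t ∈ Icc (0 : ℝ) 1
    · obtain ⟨N, hN, h⟩ := h𝒩.exists_nestSize_eq (mul_nonneg hcpos.le ht.1)
        (mul_le_of_le_one_right hcpos.le ht.2)
      exact ⟨N, fun _ => ⟨hN, h⟩⟩
    · exact ⟨0, fun h => absurd h ht⟩
  choose F hF using hex
  have hmono : StrictMonoOn F (Icc 0 1) := by
    intro s hs t ht hst
    rw [← hlt _ (hF s hs).1 _ (hF t ht).1, (hF s hs).2, (hF t ht).2]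
    exact mul_lt_mul_of_pos_left hst hcpos
  refine ⟨F, ?_, hmono, fun x => ?_⟩
  · apply Subset.antisymm
    · rintro _ ⟨t, ht, rfl⟩
      exact (hF t ht).1
    · intro N hN
      have ht : nestSize N / c ∈ Icc (0 : ℝ) 1 :=
        ⟨div_nonneg (nestSize_nonneg _) hcpos.le, (div_le_one hcpos).2 (hle1 N hN)⟩
      refine ⟨nestSize N / c, ht, hinj _ (hF _ ht).1 N hN ?_⟩
      rw [(hF _ ht).2]
      field_simp
  · -- On the dense sequence `F` is Hölder continuous, and the general case follows by approximation.
    have hmain : ∀ n, ∀ s ∈ Icc (0 : ℝ) 1, ∀ t ∈ Icc (0 : ℝ) 1, s ≤ t →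
        nestWeight H n * ‖F t (TopologicalSpace.denseSeq H n) -
          F s (TopologicalSpace.denseSeq H n)‖ ^ 2 ≤ c * (t - s) := by
      intro n s hs t ht hst
      have ps := h𝒩.isStarProjection _ (hF s hs).1
      have pt := h𝒩.isStarProjection _ (hF t ht).1
      have hle := hmono.monotoneOn hs ht hst
      have := le_nestSize (isStarProjection_sub ps pt hle) n
      rw [sub_apply] at this
      have h2 := nestSize_add ps pt hle
      rw [(hF s hs).2, (hF t ht).2] at h2
      linarith
    intro t ht
    rw [Metric.continuousWithinAt_iff]
    intro ε hε
    obtain ⟨_, hu, n, rfl⟩ := Metric.dense_iff.1 (TopologicalSpace.denseRange_denseSeq H) x (ε / 3)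
      (by positivity)
    rw [Metric.mem_ball, dist_comm, dist_eq_norm] at hu
    have hw := nestWeight_pos (H := H) n
    refine ⟨nestWeight H n * (ε / 3) ^ 2 / c, by positivity, fun s hs hst => ?_⟩
    have h1 : ‖F s (TopologicalSpace.denseSeq H n) - F t (TopologicalSpace.denseSeq H n)‖ < ε / 3 := by
      have h2 : nestWeight H n * ‖F s (TopologicalSpace.denseSeq H n) -
          F t (TopologicalSpace.denseSeq H n)‖ ^ 2 ≤ c * |s - t| := by
        rcases le_total s t with h | h
        · rw [norm_sub_rev, abs_sub_comm, abs_of_nonneg (sub_nonneg.2 h)]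
          exact hmain n s hs t ht h
        · rw [abs_of_nonneg (sub_nonneg.2 h)]
          exact hmain n t ht s hs h
      rw [Real.dist_eq, lt_div_iff₀ hcpos] at hst
      have h3 := lt_of_mul_lt_mul_left (h2.trans_lt ((mul_comm _ _).trans_lt hst)) hw.le
      exact lt_of_pow_lt_pow_left₀ 2 (by positivity) h3
    have h4 : ∀ r ∈ Icc (0 : ℝ) 1, ‖F r x - F r (TopologicalSpace.denseSeq H n)‖ < ε / 3 := by
      intro r hr
      rw [← map_sub]
      exact (norm_apply_le (h𝒩.isStarProjection _ (hF r hr).1) _).trans_lt hu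
    have h5 := h4 s hs
    have h6 := h4 t ht
    rw [← dist_eq_norm] at h1 h5 h6
    rw [dist_comm] at h6
    linarith [dist_triangle4 (F s x) (F s (TopologicalSpace.denseSeq H n))
      (F t (TopologicalSpace.denseSeq H n)) (F t x)]

theorem IsUnitParametrization.isRealParametrization {𝒩 : Set (H →L[ℂ] H)}
    (h𝒩 : IsContinuousNest 𝒩) {F : ℝ → (H →L[ℂ] H)} (hF : IsUnitParametrization 𝒩 F) :
    ∃ N, IsRealParametrization 𝒩 N := by
  let h := orderIsoIooNegOneOne ℝ
  let s : ℝ → ℝ := fun t => ((h t : ℝ) + 1) / 2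
  have hs : ∀ t, s t ∈ Ioo (0 : ℝ) 1 := fun t => by
    have h1 := (h t).2.1
    have h2 := (h t).2.2
    constructor <;> dsimp only [s] <;> linarith
  have hsm : StrictMono s := fun a b hab => by
    have : (h a : ℝ) < h b := h.strictMono hab
    dsimp only [s]
    linarith
  have hsc : Continuous s := by
    have : Continuous fun t => (h t : ℝ) := continuous_subtype_val.comp h.continuous
    exact (this.add continuous_const).div_const 2
  have hsI : ∀ t, s t ∈ Icc (0 : ℝ) 1 := fun t => Ioo_subset_Icc_self (hs t)
  have m0 : (0 : ℝ) ∈ Icc (0 : ℝ) 1 := ⟨le_rfl, zero_le_one⟩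
  have m1 : (1 : ℝ) ∈ Icc (0 : ℝ) 1 := ⟨zero_le_one, le_rfl⟩
  have hF0 : F 0 = 0 := by
    obtain ⟨t, ht, h⟩ := hF.image_eq.symm ▸ h𝒩.zero_mem
    refine le_antisymm ?_ (h𝒩.isStarProjection _ (hF.mem le_rfl zero_le_one)).nonneg
    rw [← h]
    exact hF.strictMonoOn.monotoneOn m0 ht ht.1
  have hF1 : F 1 = 1 := by
    obtain ⟨t, ht, h⟩ := hF.image_eq.symm ▸ h𝒩.one_mem
    refine le_antisymm (h𝒩.isStarProjection _ (hF.mem zero_le_one le_rfl)).le_one ?_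
    rw [← h]
    exact hF.strictMonoOn.monotoneOn ht m1 ht.2
  refine ⟨fun t => F (s t), fun x => ?_, fun a b hab => hF.strictMonoOn (hsI a) (hsI b) (hsm hab),
    ?_⟩
  · exact (hF.continuousOn x).comp_continuous hsc hsI
  · apply Subset.antisymm
    · rintro _ ⟨t, rfl⟩
      refine ⟨hF.mem (hs t).1.le (hs t).2.le, ?_⟩
      rintro (h' | h')
      · rw [← hF0] at h'
        exact (hs t).1.ne' (hF.strictMonoOn.injOn (hsI t) m0 h')
      · rw [mem_singleton_iff, ← hF1] at h'
        exact (hs t).2.ne (hF.strictMonoOn.injOn (hsI t) m1 h')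
    · rintro N ⟨hN, hne⟩
      rw [← hF.image_eq] at hN
      obtain ⟨t, ht, rfl⟩ := hN
      have ht0 : t ≠ 0 := fun h' => hne (Or.inl (by rw [h', hF0]))
      have ht1 : t ≠ 1 := fun h' => hne (Or.inr (by rw [h', hF1]; rfl))
      have h1 : 0 < t := lt_of_le_of_ne ht.1 (Ne.symm ht0)
      have h2 : t < 1 := lt_of_le_of_ne ht.2 ht1
      refine ⟨h.symm ⟨2 * t - 1, by linarith, by linarith⟩, ?_⟩
      dsimp only [s]
      rw [OrderIso.apply_symm_apply]
      congr 1
      ring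

end Parametrization

/-! ### Ideals of nets and cofinality -/

section Ideals

variable {H : Type*} [NormedAddCommGroup H] [InnerProductSpace ℂ H] [CompleteSpace H]
  {𝒩 : Set (H →L[ℂ] H)} {F : ℝ → (H →L[ℂ] H)}

theorem supEssNorm_nonneg (P : Set (H →L[ℂ] H)) (X : H →L[ℂ] H) : 0 ≤ supEssNorm P X := by
  refine Real.sSup_nonneg ?_
  rintro _ ⟨E, -, rfl⟩
  exact essNorm_nonneg _

theorem essNorm_le_supEssNorm {P : Set (H →L[ℂ] H)} (hP : ∀ E ∈ P, IsStarProjection E)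
    (X : H →L[ℂ] H) {E : H →L[ℂ] H} (hE : E ∈ P) : essNorm (E * X * E) ≤ supEssNorm P X := by
  refine le_csSup ⟨‖X‖, ?_⟩ ⟨E, hE, rfl⟩
  rintro _ ⟨G, hG, rfl⟩
  exact (essNorm_le_norm _).trans (norm_compression_le (hP G hG) X)

theorem supEssNorm_le {P : Set (H →L[ℂ] H)} {X : H →L[ℂ] H} {c : ℝ} (hc : 0 ≤ c)
    (h : ∀ E ∈ P, essNorm (E * X * E) ≤ c) : supEssNorm P X ≤ c := by
  refine Real.sSup_le ?_ hc
  rintro _ ⟨E, hE, rfl⟩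
  exact h E hE

theorem Refines.supEssNorm_le {P Q : Set (H →L[ℂ] H)} (hP : ∀ E ∈ P, IsStarProjection E)
    (hQ : ∀ E ∈ Q, IsStarProjection E) (h : Refines P Q) (X : H →L[ℂ] H) :
    supEssNorm P X ≤ supEssNorm Q X := by
  refine NestAlgebra.supEssNorm_le (supEssNorm_nonneg _ _) fun E hE => ?_
  obtain ⟨G, hG, hle⟩ := h E hE
  exact (essNorm_compression_mono (hP E hE) (hQ G hG) hle X).trans
    (essNorm_le_supEssNorm hQ X hG)

theorem Refines.trans {P Q R : Set (H →L[ℂ] H)} (h : Refines P Q) (h' : Refines Q R) :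
    Refines P R := by
  intro E hE
  obtain ⟨G, hG, hle⟩ := h E hE
  obtain ⟨K, hK, hle'⟩ := h' G hG
  exact ⟨K, hK, hle.trans hle'⟩

theorem refines_refl (P : Set (H →L[ℂ] H)) : Refines P P := fun E hE => ⟨E, hE, le_rfl⟩

theorem IsNet.isStarProjection (h𝒩 : IsContinuousNest 𝒩) {O : Set (Set (H →L[ℂ] H))}
    (hO : IsNet 𝒩 O) {P : Set (H →L[ℂ] H)} (hP : P ∈ O) : ∀ E ∈ P, IsStarProjection E :=
  fun E hE => (hO.isInterval P hP E hE).isStarProjection h𝒩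

theorem netIdeal_subset_of_isCofinalIn (h𝒩 : IsContinuousNest 𝒩)
    {O₁ O₂ : Set (Set (H →L[ℂ] H))} (h₁ : IsNet 𝒩 O₁) (h₂ : IsNet 𝒩 O₂)
    (h : IsCofinalIn O₁ O₂) : netIdeal 𝒩 O₂ ⊆ netIdeal 𝒩 O₁ := by
  rintro X ⟨hX, hlim⟩
  refine ⟨hX, fun ε hε => ?_⟩
  obtain ⟨Q, hQ, hlt⟩ := hlim ε hε
  obtain ⟨P, hP, hPQ⟩ := h Q hQ
  refine ⟨P, hP, fun P' hP' href => ?_⟩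
  have h3 := hlt Q hQ (refines_refl Q)
  rw [abs_of_nonneg (supEssNorm_nonneg _ _)] at h3 ⊢
  exact ((href.trans hPQ).supEssNorm_le (h₁.isStarProjection h𝒩 hP') (h₂.isStarProjection h𝒩 hQ)
    X).trans_lt h3

/-- An automorphism of `[0, 1]` induces an order automorphism of the nest. -/
theorem IsUnitParametrization.exists_orderIso (hF : IsUnitParametrization 𝒩 F) (θ : ℝ ≃o ℝ)
    (h0 : θ 0 = 0) (h1 : θ 1 = 1) :
    ∃ Θ : 𝒩 ≃o 𝒩, ∀ t (ht : F t ∈ 𝒩), 0 ≤ t → t ≤ 1 → (Θ ⟨F t, ht⟩ : H →L[ℂ] H) = F (θ t) := by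
  have himg := hF.image_eq
  subst himg
  let τ : Icc (0 : ℝ) 1 ≃o Icc (0 : ℝ) 1 :=
    { toFun := fun t => ⟨θ t, h0.symm.le.trans (θ.monotone t.2.1),
        (θ.monotone t.2.2).trans h1.le⟩
      invFun := fun t => ⟨θ.symm t, by rw [OrderIso.le_symm_apply, h0]; exact t.2.1,
        by rw [OrderIso.symm_apply_le, h1]; exact t.2.2⟩
      left_inv := fun t => by simp
      right_inv := fun t => by simp
      map_rel_iff' := by
        intro a b
        exact θ.le_iff_le }
  let ψ := hF.strictMonoOn.orderIso
  refine ⟨ψ.symm.trans (τ.trans ψ), fun t ht ht0 ht1 => ?_⟩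
  have e : ψ.symm ⟨F t, ht⟩ = ⟨t, ht0, ht1⟩ := by
    rw [OrderIso.symm_apply_eq]
    rfl
  simp only [OrderIso.trans_apply, e]
  rfl

/-- The relation `D a b`: the interval `[a, b]` of the nest lies below a member of `Q`. -/
def belowFamily (F : ℝ → (H →L[ℂ] H)) (Q : Set (H →L[ℂ] H)) (a b : ℝ) : Prop :=
  0 ≤ a ∧ a < b ∧ b ≤ 1 ∧ ∃ G ∈ Q, F b - F a ≤ G

theorem IsUnitParametrization.isDownset_belowFamily (hF : IsUnitParametrization 𝒩 F)
    (Q : Set (H →L[ℂ] H)) : IsDownset (belowFamily F Q) where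
  lt h := h.2.1
  nonneg h := h.1
  le_one h := h.2.2.1
  mono := by
    rintro a b a' b' ⟨h0, hab, h1, G, hG, hle⟩ ha hab' hb
    refine ⟨h0.trans ha, hab', hb.trans h1, G, hG, le_trans ?_ hle⟩
    have hm := hF.strictMonoOn.monotoneOn
    exact sub_le_sub
      (hm ⟨(h0.trans ha).trans hab'.le, hb.trans h1⟩ ⟨h0.trans hab.le, h1⟩ hb)
      (hm ⟨h0, hab.le.trans h1⟩ ⟨h0.trans ha, (hab'.le.trans hb).trans h1⟩ ha)

theorem IsUnitParametrization.le_and_le_of_sub_le_sub (hF : IsUnitParametrization 𝒩 F)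
    (h𝒩 : IsContinuousNest 𝒩) {a b c d : ℝ} (ha : 0 ≤ a) (hab : a < b) (hb : b ≤ 1) (hc : 0 ≤ c)
    (hcd : c ≤ d) (hd : d ≤ 1) (h : F b - F a ≤ F d - F c) : c ≤ a ∧ b ≤ d := by
  have ma : a ∈ Icc (0 : ℝ) 1 := ⟨ha, hab.le.trans hb⟩
  have mb : b ∈ Icc (0 : ℝ) 1 := ⟨ha.trans hab.le, hb⟩
  have mc : c ∈ Icc (0 : ℝ) 1 := ⟨hc, hcd.trans hd⟩
  have md : d ∈ Icc (0 : ℝ) 1 := ⟨hc.trans hcd, hd⟩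
  have := h𝒩.le_and_le_of_sub_le_sub (hF.mem ma.1 ma.2) (hF.mem mb.1 mb.2) (hF.mem mc.1 mc.2)
    (hF.mem md.1 md.2) (hF.strictMonoOn ma mb hab) (hF.strictMonoOn.monotoneOn mc md hcd) h
  exact ⟨(hF.strictMonoOn.le_iff_le mc ma).1 this.1, (hF.strictMonoOn.le_iff_le mb md).1 this.2⟩

theorem IsUnitParametrization.belowFamily_symm (hF : IsUnitParametrization 𝒩 F)
    (h𝒩 : IsContinuousNest 𝒩) {θ : ℝ ≃o ℝ} (h0 : θ 0 = 0) (h1 : θ 1 = 1) {Θ : 𝒩 ≃o 𝒩}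
    (hΘ : ∀ t (ht : F t ∈ 𝒩), 0 ≤ t → t ≤ 1 → (Θ ⟨F t, ht⟩ : H →L[ℂ] H) = F (θ t))
    {Q : Set (H →L[ℂ] H)} {G : H →L[ℂ] H} (hG : G ∈ imageFamily Θ Q) {a b : ℝ} (ha : 0 ≤ a)
    (hab : a < b) (hb : b ≤ 1) (hle : F b - F a ≤ G) :
    belowFamily F Q (θ.symm a) (θ.symm b) := by
  obtain ⟨⟨M, hM⟩, ⟨N, hN⟩, hMN, hmem, rfl⟩ := hG
  have hM' := hM
  have hN' := hN
  rw [← hF.image_eq] at hM' hN'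
  obtain ⟨c, hc, rfl⟩ := hM'
  obtain ⟨d, hd, rfl⟩ := hN'
  have hcd : c ≤ d := (hF.strictMonoOn.le_iff_le hc hd).1 hMN
  rw [hΘ c hM hc.1 hc.2, hΘ d hN hd.1 hd.2] at hle
  have key := hF.le_and_le_of_sub_le_sub h𝒩 ha hab hb (h0 ▸ θ.monotone hc.1) (θ.monotone hcd)
    (h1 ▸ θ.monotone hd.2) hle
  have k1 : c ≤ θ.symm a := (OrderIso.le_symm_apply _).2 key.1
  have k2 : θ.symm b ≤ d := (OrderIso.symm_apply_le _).2 key.2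
  exact (hF.isDownset_belowFamily Q).mono (a := c) (b := d)
    ⟨hc.1, (k1.trans_lt (θ.symm.strictMono hab)).trans_le k2, hd.2, _, hmem, le_rfl⟩ k1
    (θ.symm.strictMono hab) k2

/-- Every family in the net `O` that is fine enough contains no interval from `M`. -/
def Avoids (F : ℝ → (H →L[ℂ] H)) (O : Set (Set (H →L[ℂ] H))) (M : Set (ℝ × ℝ)) : Prop :=
  ∃ P ∈ O, ∀ P' ∈ O, Refines P' P → ∀ e ∈ M, 0 ≤ e.1 → e.1 < e.2 → e.2 ≤ 1 →
    F e.2 - F e.1 ∉ P'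

/-- The operator built from the pairs that detect `M` belongs to the ideal of `O₂`, by the stability
of `O₂`. If it belongs to the ideal of `O₁` as well, then `O₁` avoids `M`. -/
theorem IsDetected.avoids (h𝒩 : IsContinuousNest 𝒩) (hF : IsUnitParametrization 𝒩 F)
    {O₁ O₂ : Set (Set (H →L[ℂ] H))} (h₁ : IsNet 𝒩 O₁) (h₂ : IsNet 𝒩 O₂) (hs₂ : IsStable 𝒩 O₂)
    (hsub : netIdeal 𝒩 O₂ ⊆ netIdeal 𝒩 O₁) {Q : Set (H →L[ℂ] H)} (hQ : Q ∈ O₂)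
    {M : Set (ℝ × ℝ)} (hM : IsDetected (belowFamily F Q) M) : Avoids F O₁ M := by
  obtain ⟨θ, ι, hι, α, β, γ, δ, h0, h1, hq, hinf, hfin⟩ := hM
  obtain ⟨e, he, heI⟩ := hF.exists_orthonormal h𝒩 α β (fun i => (hq i).1) (fun i => (hq i).2.1)
    (fun i => by linarith [hq i])
  obtain ⟨f, hf, hfI⟩ := hF.exists_orthonormal h𝒩 γ δ (fun i => by linarith [hq i])
    (fun i => (hq i).2.2.2.1) (fun i => (hq i).2.2.2.2)
  obtain ⟨X, hXf, hX⟩ := exists_partialIsometry he hf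
  have hαδ : ∀ i, 0 ≤ α i ∧ α i ≤ β i ∧ β i ≤ γ i ∧ γ i ≤ δ i ∧ δ i ≤ 1 ∧ β i ≤ 1 ∧ 0 ≤ γ i ∧
      0 ≤ β i ∧ γ i ≤ 1 := fun i => by
    obtain ⟨q1, q2, q3, q4, q5⟩ := hq i
    refine ⟨?_, ?_, ?_, ?_, ?_, ?_, ?_, ?_, ?_⟩ <;> linarith
  have hXalg : X ∈ nestAlg 𝒩 := by
    intro N hN
    have pN := h𝒩.isStarProjection N hN
    rw [← hF.image_eq] at hN
    obtain ⟨t, ht, rfl⟩ := hN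
    ext x
    refine ext_inner_left ℂ fun y => ?_
    have key := hX (F t x) (y - F t y)
    have hz : ∀ i, inner ℂ (y - F t y) (e i) * inner ℂ (f i) (F t x) = 0 := by
      intro i
      obtain ⟨q1, q2, q3, q4, q5, q6, q7, q8, q9⟩ := hαδ i
      rcases le_total (β i) t with h | h
      · rw [inner_sub_left, inner_apply_left pN, hF.apply_eq_self h𝒩 q1 q2 h ht.2 (heI i),
          sub_self, zero_mul]
      · rw [← inner_apply_left pN, hF.apply_eq_zero h𝒩 ht.1 (h.trans q3) q4 q5 (hfI i),
          inner_zero_left, mul_zero]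
    simp only [hz] at key
    have := key.unique hasSum_zero
    rw [inner_sub_left, sub_eq_zero, inner_apply_left pN] at this
    exact this
  have hXmem : X ∈ netIdeal 𝒩 O₂ := by
    refine ⟨hXalg, fun ε hε => ?_⟩
    obtain ⟨Θ, hΘ⟩ := hF.exists_orderIso θ h0 h1
    obtain ⟨P₀, hP₀, hr, hr'⟩ := h₂.directed Q hQ (imageFamily Θ Q) (hs₂ Θ Q hQ)
    refine ⟨P₀, hP₀, fun P hP href => ?_⟩
    rw [abs_of_nonneg (supEssNorm_nonneg _ _)]
    refine (supEssNorm_le le_rfl fun E hE => ?_).trans_lt hε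
    obtain ⟨a, b, ha, hab, hb, rfl⟩ := hF.exists_of_isInterval (h₂.isInterval P hP E hE)
    refine (essNorm_eq_zero_of_isCompactOperator ?_).le
    rcases hab.eq_or_lt with rfl | hab
    · simpa using isCompactOperator_zero
    obtain ⟨G, hG, hle⟩ := href.trans hr _ hE
    obtain ⟨G', hG', hle'⟩ := href.trans hr' _ hE
    refine isCompactOperator_compression hX ((hF.isInterval ha hab.le hb).isStarProjection h𝒩)
      ((hfin a b ⟨ha, hab, hb, G, hG, hle⟩
        (hF.belowFamily_symm h𝒩 h0 h1 hΘ hG' ha hab hb hle')).subset ?_)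
    rintro i ⟨hei, hfi⟩
    obtain ⟨q1, q2, q3, q4, q5, q6, q7, q8, q9⟩ := hαδ i
    constructor
    · by_contra hc
      have hc : β i ≤ a := not_lt.1 hc
      apply hei
      rw [sub_apply, hF.apply_eq_self h𝒩 q1 q2 hc (hab.le.trans hb) (heI i),
        hF.apply_eq_self h𝒩 q1 q2 (hc.trans hab.le) hb (heI i), sub_self]
    · by_contra hc
      have hc : b ≤ γ i := not_lt.1 hc
      apply hfi
      rw [sub_apply, hF.apply_eq_zero h𝒩 ha (hab.le.trans hc) q4 q5 (hfI i),
        hF.apply_eq_zero h𝒩 (ha.trans hab.le) hc q4 q5 (hfI i), sub_self]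
  obtain ⟨P, hP, hlt⟩ := (hsub hXmem).2 1 one_pos
  refine ⟨P, hP, fun P' hP' href e' he' ha hab hb hmem => ?_⟩
  obtain ⟨a, b⟩ := e'
  dsimp only at *
  have h3 := hlt P' hP' href
  rw [abs_of_nonneg (supEssNorm_nonneg _ _)] at h3
  have h4 := (essNorm_le_supEssNorm (h₁.isStarProjection h𝒩 hP') X hmem).trans_lt h3
  refine absurd (one_le_essNorm he hf (hinf a b he') fun i hi => ?_) (not_le.2 h4)
  obtain ⟨hai, hib⟩ := hi
  obtain ⟨q1, q2, q3, q4, q5, q6, q7, q8, q9⟩ := hαδ i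
  have k1 : (F b - F a) (f i) = f i := by
    rw [sub_apply, hF.apply_eq_self h𝒩 q7 q4 hib hb (hfI i),
      hF.apply_eq_zero h𝒩 ha (hai.trans (q2.trans q3)) q4 q5 (hfI i), sub_zero]
  have k2 : (F b - F a) (e i) = e i := by
    rw [sub_apply, hF.apply_eq_self h𝒩 q1 q2 ((q3.trans q4).trans hib) hb (heI i),
      hF.apply_eq_zero h𝒩 ha hai q2 q6 (heI i), sub_zero]
  rw [mul_apply_eq_comp, mul_apply_eq_comp, k1, hXf, k2]

theorem IsDetectable.avoids (h𝒩 : IsContinuousNest 𝒩) (hF : IsUnitParametrization 𝒩 F)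
    {O₁ O₂ : Set (Set (H →L[ℂ] H))} (h₁ : IsNet 𝒩 O₁) (h₂ : IsNet 𝒩 O₂) (hs₂ : IsStable 𝒩 O₂)
    (hsub : netIdeal 𝒩 O₂ ⊆ netIdeal 𝒩 O₁) {Q : Set (H →L[ℂ] H)} (hQ : Q ∈ O₂)
    {M : Set (ℝ × ℝ)} (hM : IsDetectable (belowFamily F Q) M) : Avoids F O₁ M := by
  induction hM with
  | of h => exact h.avoids h𝒩 hF h₁ h₂ hs₂ hsub hQ
  | union _ _ ih₁ ih₂ =>
    obtain ⟨P₁, hP₁, h3⟩ := ih₁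
    obtain ⟨P₂, hP₂, h4⟩ := ih₂
    obtain ⟨P, hP, hr₁, hr₂⟩ := h₁.directed P₁ hP₁ P₂ hP₂
    refine ⟨P, hP, fun P' hP' href e he => ?_⟩
    rcases he with he | he
    · exact h3 P' hP' (href.trans hr₁) e he
    · exact h4 P' hP' (href.trans hr₂) e he
  | mono _ hs ih =>
    obtain ⟨P, hP, h3⟩ := ih
    exact ⟨P, hP, fun P' hP' href e he => h3 P' hP' href e (hs he)⟩

/-- Inclusion of ideals forces cofinality: only the second net has to be stable. Applied to the
complement of the intervals below `Q`, detectability yields a family in `O₁` all of whose members lie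
below members of `Q`. -/
theorem isCofinalIn_of_netIdeal_subset (h𝒩 : IsContinuousNest 𝒩) (hF : IsUnitParametrization 𝒩 F)
    {O₁ O₂ : Set (Set (H →L[ℂ] H))} (h₁ : IsNet 𝒩 O₁) (h₂ : IsNet 𝒩 O₂) (hs₂ : IsStable 𝒩 O₂)
    (hne : ∀ Q ∈ O₂, Q.Nonempty) (hsub : netIdeal 𝒩 O₂ ⊆ netIdeal 𝒩 O₁) : IsCofinalIn O₁ O₂ := by
  intro Q hQ
  obtain ⟨P, hP, havoid⟩ := ((hF.isDownset_belowFamily Q).isDetectable_compl).avoids h𝒩 hF h₁ h₂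
    hs₂ hsub hQ
  refine ⟨P, hP, fun E hE => ?_⟩
  obtain ⟨a, b, ha, hab, hb, rfl⟩ := hF.exists_of_isInterval (h₁.isInterval P hP E hE)
  rcases hab.eq_or_lt with rfl | hab
  · obtain ⟨G, hG⟩ := hne Q hQ
    refine ⟨G, hG, ?_⟩
    rw [sub_self]
    exact (h₂.isStarProjection h𝒩 hQ G hG).nonneg
  · by_contra hcon
    exact havoid P hP (refines_refl P) (a, b)
      ⟨ha, hab, hb, fun h => hcon h.2.2.2⟩ ha hab hb hE

end Ideals

/-! ### Nets of intervals of unit length -/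

section UnitIntervals

variable {H : Type*} [NormedAddCommGroup H] [InnerProductSpace ℂ H] [CompleteSpace H]

/-- Finite-rank projections, namely those onto the spans of initial segments of a dense sequence,
which asymptotically fix each compact operator in norm. -/
theorem exists_approximateUnit [TopologicalSpace.SeparableSpace H] :
    ∃ R : ℕ → H →L[ℂ] H, (∀ n, IsCompactOperator (R n)) ∧ (∀ n, ‖1 - R n‖ ≤ 1) ∧
      ∀ K : H →L[ℂ] H, IsCompactOperator K → ∀ ε : ℝ, 0 < ε → ∃ n, ‖(1 - R n) * K‖ < ε := by
  let u := TopologicalSpace.denseSeq H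
  let W : ℕ → Submodule ℂ H := fun n => Submodule.span ℂ (u '' Iio n)
  have hW : ∀ n, FiniteDimensional ℂ (W n) := fun n =>
    FiniteDimensional.span_of_finite ℂ ((finite_lt_nat n).image u)
  have hR : ∀ n, IsStarProjection (W n).starProjection := fun n => isStarProjection_starProjection
  have hnorm : ∀ n, ‖1 - (W n).starProjection‖ ≤ 1 := fun n =>
    IsStarProjection.norm_le _ (hR n).one_sub
  refine ⟨fun n => (W n).starProjection, fun n => ?_, hnorm, fun K hK ε hε => ?_⟩
  · have h : IsCompactOperator ((W n).subtypeL : W n →L[ℂ] H) :=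
      isCompactOperator_of_locallyCompactSpace_rng _
    exact h.comp_clm (W n).orthogonalProjectionOnto
  · obtain ⟨C, hC, hsub⟩ := hK.image_closedBall_subset_compact (f := K.toLinearMap) 1
    obtain ⟨t, ht⟩ := hC.elim_finite_subcover (fun m => Metric.ball (u m) (ε / 2))
      (fun m => Metric.isOpen_ball) fun x _ => by
        obtain ⟨_, hx, m, rfl⟩ := Metric.dense_iff.1 (TopologicalSpace.denseRange_denseSeq H) x
          (ε / 2) (by positivity)
        exact mem_iUnion.2 ⟨m, by rw [Metric.mem_ball, dist_comm]; exact hx⟩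
    refine ⟨t.sup id + 1, lt_of_le_of_lt ?_ (half_lt_self hε)⟩
    refine ContinuousLinearMap.opNorm_le_of_unit_norm (by positivity) fun x hx => ?_
    have hmem := ht (hsub ⟨x, by simp [hx], rfl⟩)
    simp only [mem_iUnion, exists_prop] at hmem
    obtain ⟨m, hm, hmx⟩ := hmem
    have hm' : m < t.sup id + 1 := Nat.lt_succ_of_le (Finset.le_sup (f := id) hm)
    have hfix : (1 - (W (t.sup id + 1)).starProjection) (u m) = 0 := by
      rw [sub_apply, Submodule.starProjection_eq_self_iff.2
        (Submodule.subset_span (show u m ∈ u '' Iio (t.sup id + 1) from ⟨m, hm', rfl⟩))]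
      simp
    have : ((1 - (W (t.sup id + 1)).starProjection) * K) x =
        (1 - (W (t.sup id + 1)).starProjection) (K x - u m) := by
      rw [map_sub, hfix, sub_zero]; rfl
    rw [this]
    refine (ContinuousLinearMap.le_opNorm _ _).trans ?_
    refine (mul_le_of_le_one_left (norm_nonneg _) (hnorm _)).trans ?_
    rw [← dist_eq_norm]
    exact (Metric.mem_ball.1 hmx).le

theorem isOpen_lt_opNorm {T : ℝ → H →L[ℂ] H} (hT : ∀ x, Continuous fun s => T s x) (c : ℝ) :
    IsOpen {s | c < ‖T s‖} := by
  have : {s | c < ‖T s‖} = ⋃ x ∈ Metric.ball (0 : H) 1, {s | c < ‖T s x‖} := by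
    ext s
    simp only [mem_ofPred_eq, mem_iUnion, exists_prop, Metric.mem_ball, dist_zero_right]
    constructor
    · exact fun h => ContinuousLinearMap.exists_lt_apply_of_lt_opNorm (T s) h
    · rintro ⟨x, hx, h⟩
      refine h.trans_le ((ContinuousLinearMap.le_opNorm _ _).trans ?_)
      exact mul_le_of_le_one_right (norm_nonneg _) hx.le
  rw [this]
  exact isOpen_biUnion fun x _ => isOpen_lt continuous_const (hT x).norm

/-- For a strongly continuous family of operators, the essential norm is at least `ε` on a `Gδ` set:
it is the infimum over `n` of the lower semicontinuous functions `s ↦ ‖(1 - R n) * T s‖`, where `R n`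
is the `n`-th member of an approximate unit of finite-rank projections. -/
theorem isGδ_le_essNorm [TopologicalSpace.SeparableSpace H] {T : ℝ → H →L[ℂ] H}
    (hT : ∀ x, Continuous fun s => T s x) (ε : ℝ) : IsGδ {s | ε ≤ essNorm (T s)} := by
  obtain ⟨R, hRc, hRn, hR⟩ := exists_approximateUnit (H := H)
  have hiff : ∀ Y : H →L[ℂ] H, essNorm Y < ε ↔ ∃ n, ‖(1 - R n) * Y‖ < ε := by
    intro Y
    rw [essNorm_lt_iff]
    constructor
    · rintro ⟨K, hK, hlt⟩
      obtain ⟨n, hn⟩ := hR K hK (ε - ‖Y - K‖) (sub_pos.2 hlt)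
      refine ⟨n, ?_⟩
      have h1 : ‖(1 - R n) * (Y - K)‖ ≤ ‖Y - K‖ :=
        (norm_mul_le _ _).trans (mul_le_of_le_one_left (norm_nonneg _) (hRn n))
      have h2 : (1 - R n) * Y = (1 - R n) * (Y - K) + (1 - R n) * K := by
        rw [← mul_add, sub_add_cancel]
      rw [h2]
      linarith [norm_add_le ((1 - R n) * (Y - K)) ((1 - R n) * K)]
    · rintro ⟨n, hn⟩
      refine ⟨R n * Y, (hRc n).comp_clm Y, ?_⟩
      rwa [sub_mul, one_mul] at hn
  have hset : {s | ε ≤ essNorm (T s)} =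
      ⋂ n : ℕ, ⋂ m : ℕ, {s | ε - 1 / ((m : ℝ) + 1) < ‖(1 - R n) * T s‖} := by
    ext s
    simp only [mem_ofPred_eq, mem_iInter]
    rw [← not_lt, hiff]
    push Not
    refine forall_congr' fun n => ⟨fun h m => ?_, fun h => ?_⟩
    · have : (0 : ℝ) < 1 / ((m : ℝ) + 1) := by positivity
      linarith
    · by_contra hc
      obtain ⟨m, hm⟩ := exists_nat_one_div_lt (sub_pos.2 (not_le.1 hc))
      linarith [h m]
  rw [hset]
  refine .iInter fun n => .iInter fun m => (isOpen_lt_opNorm (fun x => ?_) _).isGδ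
  exact (1 - R n).continuous.comp (hT x)

theorem continuous_apply_of_norm_le_one {A : ℝ → H →L[ℂ] H} (hA : ∀ s, ‖A s‖ ≤ 1)
    (hc : ∀ x, Continuous fun s => A s x) {y : ℝ → H} (hy : Continuous y) :
    Continuous fun s => A s (y s) := by
  rw [continuous_iff_continuousAt]
  intro t
  have h1 : Filter.Tendsto (fun s => A s (y s - y t)) (𝓝 t) (𝓝 0) := by
    refine squeeze_zero_norm (a := fun s => ‖y s - y t‖) (fun s => ?_) ?_
    · exact ((A s).le_opNorm _).trans (mul_le_of_le_one_left (norm_nonneg _) (hA s))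
    · have : Continuous fun s => ‖y s - y t‖ := (hy.sub continuous_const).norm
      simpa using this.tendsto t
  have h2 := h1.add ((hc (y t)).tendsto t)
  rw [zero_add] at h2
  refine h2.congr fun s => ?_
  rw [map_sub, sub_add_cancel]

variable {𝒩 : Set (H →L[ℂ] H)} {N : ℝ → (H →L[ℂ] H)}

namespace IsRealParametrization

theorem mem (hN : IsRealParametrization 𝒩 N) (t : ℝ) : N t ∈ 𝒩 :=
  (hN.range_eq ▸ mem_range_self t : N t ∈ 𝒩 \ {0, 1}).1

theorem isInterval (hN : IsRealParametrization 𝒩 N) (s : ℝ) : IsInterval 𝒩 (N (s + 1) - N s) :=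
  ⟨N s, hN.mem s, N (s + 1), hN.mem _, hN.strictMono.monotone (by linarith), rfl⟩

theorem eq_of_le (hN : IsRealParametrization 𝒩 N) (h𝒩 : IsContinuousNest 𝒩) {s r : ℝ}
    (h : N (s + 1) - N s ≤ N (r + 1) - N r) : s = r := by
  have := h𝒩.le_and_le_of_sub_le_sub (hN.mem s) (hN.mem (s + 1)) (hN.mem r) (hN.mem (r + 1))
    (hN.strictMono (by linarith)) (hN.strictMono.monotone (by linarith)) h
  have h1 := hN.strictMono.le_iff_le.1 this.1
  have h2 := hN.strictMono.le_iff_le.1 this.2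
  linarith

open Classical in
/-- The map `N t ↦ N (t + c)`, which fixes all operators that are not of the form `N t`. -/
def shift (N : ℝ → (H →L[ℂ] H)) (c : ℝ) (M : H →L[ℂ] H) : H →L[ℂ] H :=
  if h : ∃ t, N t = M then N (h.choose + c) else M

theorem shift_apply (hN : IsRealParametrization 𝒩 N) (c t : ℝ) : shift N c (N t) = N (t + c) := by
  have h : ∃ s, N s = N t := ⟨t, rfl⟩
  rw [shift, dif_pos h, hN.strictMono.injective h.choose_spec]

/-- Translations of the parameter induce order automorphisms of the nest. -/
theorem exists_orderIso_translation (hN : IsRealParametrization 𝒩 N) (h𝒩 : IsContinuousNest 𝒩)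
    (c : ℝ) : ∃ Θ : 𝒩 ≃o 𝒩, ∀ t (ht : N t ∈ 𝒩), (Θ ⟨N t, ht⟩ : H →L[ℂ] H) = N (t + c) := by
  have hout : ∀ c M, (¬ ∃ t, N t = M) → shift N c M = M := fun c M h => by rw [shift, dif_neg h]
  have h01 : ∀ M ∈ 𝒩, (∃ t, N t = M) ∨ ((¬ ∃ t, N t = M) ∧ (M = 0 ∨ M = 1)) := by
    intro M hM
    by_cases h : ∃ t, N t = M
    · exact Or.inl h
    · refine Or.inr ⟨h, ?_⟩
      by_contra hc
      have : M ∈ range N := by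
        rw [hN.range_eq]
        exact ⟨hM, hc⟩
      exact h this
  have hpos : ∀ t, 0 < N t ∧ N t < 1 := by
    intro t
    have h1 : N t ∈ 𝒩 \ {0, 1} := hN.range_eq ▸ mem_range_self t
    have hp := h𝒩.isStarProjection _ h1.1
    exact ⟨lt_of_le_of_ne hp.nonneg fun h => h1.2 (Or.inl h.symm),
      lt_of_le_of_ne hp.le_one fun h => h1.2 (Or.inr h)⟩
  have hmem : ∀ c, ∀ M ∈ 𝒩, shift N c M ∈ 𝒩 := by
    intro c M hM
    rcases h01 M hM with ⟨t, rfl⟩ | ⟨h, -⟩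
    · rw [hN.shift_apply]; exact hN.mem _
    · rw [hout c M h]; exact hM
  have hinv : ∀ c, ∀ M ∈ 𝒩, shift N (-c) (shift N c M) = M := by
    intro c M hM
    rcases h01 M hM with ⟨t, rfl⟩ | ⟨h, -⟩
    · rw [hN.shift_apply, hN.shift_apply, add_neg_cancel_right]
    · rw [hout c M h, hout (-c) M h]
  have hle : ∀ c, ∀ M ∈ 𝒩, ∀ M' ∈ 𝒩, M ≤ M' → shift N c M ≤ shift N c M' := by
    intro c M hM M' hM' hle
    rcases h01 M hM with ⟨t, rfl⟩ | ⟨h, h'⟩ <;> rcases h01 M' hM' with ⟨t', rfl⟩ | ⟨k, k'⟩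
    · rw [hN.shift_apply, hN.shift_apply]
      have := hN.strictMono.le_iff_le.1 hle
      exact hN.strictMono.monotone (by linarith)
    · rw [hN.shift_apply, hout c M' k]
      rcases k' with rfl | rfl
      · exact absurd hle (hpos t).1.not_ge
      · exact (hpos _).2.le
    · rw [hN.shift_apply, hout c M h]
      rcases h' with rfl | rfl
      · exact (hpos _).1.le
      · exact absurd hle (hpos t').2.not_ge
    · rw [hout c M h, hout c M' k]
      exact hle
  let f : 𝒩 ≃ 𝒩 :=
    { toFun := fun M => ⟨shift N c M, hmem c M M.2⟩
      invFun := fun M => ⟨shift N (-c) M, hmem (-c) M M.2⟩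
      left_inv := fun M => Subtype.ext (hinv c M M.2)
      right_inv := fun M => Subtype.ext (by
        have := hinv (-c) M M.2
        rwa [neg_neg] at this) }
  exact ⟨f.toOrderIso (fun M M' h => hle c M M.2 M' M'.2 h)
    (fun M M' h => hle (-c) M M.2 M' M'.2 h), fun t ht => hN.shift_apply c t⟩

theorem translate_mem (hN : IsRealParametrization 𝒩 N) {c : ℝ} {Θ : 𝒩 ≃o 𝒩}
    (hΘ : ∀ t (ht : N t ∈ 𝒩), (Θ ⟨N t, ht⟩ : H →L[ℂ] H) = N (t + c)) {S : Set ℝ} {s : ℝ}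
    (hs : s ∈ S) : N (s + c + 1) - N (s + c) ∈ imageFamily Θ (unitFamily N S) := by
  refine ⟨⟨N s, hN.mem s⟩, ⟨N (s + 1), hN.mem _⟩, hN.strictMono.monotone (by linarith),
    ⟨s, hs, rfl⟩, ?_⟩
  rw [hΘ, hΘ, add_right_comm]

theorem rationalNet_isNet (hN : IsRealParametrization 𝒩 N) : IsNet 𝒩 (rationalNet N) where
  nonempty := ⟨_, range ((↑) : ℚ → ℝ), subset_rfl, by rw [sdiff_self]; exact .empty, rfl⟩
  isInterval := by
    rintro _ ⟨S, -, -, rfl⟩ _ ⟨s, -, rfl⟩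
    exact hN.isInterval s
  directed := by
    rintro _ ⟨S₁, h₁, g₁, rfl⟩ _ ⟨S₂, h₂, g₂, rfl⟩
    refine ⟨_, ⟨S₁ ∩ S₂, inter_subset_left.trans h₁, ?_, rfl⟩, ?_, ?_⟩
    · rw [sdiff_inter]
      exact g₁.union g₂
    · rintro _ ⟨s, hs, rfl⟩
      exact ⟨_, ⟨s, hs.1, rfl⟩, le_rfl⟩
    · rintro _ ⟨s, hs, rfl⟩
      exact ⟨_, ⟨s, hs.2, rfl⟩, le_rfl⟩

theorem irrationalNet_isNet (hN : IsRealParametrization 𝒩 N) : IsNet 𝒩 (irrationalNet N) where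
  nonempty := singleton_nonempty _
  isInterval := by
    rintro _ rfl _ ⟨s, -, rfl⟩
    exact hN.isInterval s
  directed := by
    rintro _ rfl _ rfl
    exact ⟨_, rfl, refines_refl _, refines_refl _⟩

theorem univ_mem_rationalNet : unitFamily N (range ((↑) : ℚ → ℝ)) ∈ rationalNet N :=
  ⟨_, subset_rfl, by rw [sdiff_self]; exact .empty, rfl⟩

theorem rationalNet_not_isStable (hN : IsRealParametrization 𝒩 N) (h𝒩 : IsContinuousNest 𝒩) :
    ¬ IsStable 𝒩 (rationalNet N) := by
  intro hs
  obtain ⟨Θ, hΘ⟩ := hN.exists_orderIso_translation h𝒩 (√2)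
  obtain ⟨S, hS, -, h⟩ := hs Θ _ univ_mem_rationalNet
  have h1 := hN.translate_mem hΘ (S := range ((↑) : ℚ → ℝ)) ⟨0, Rat.cast_zero⟩
  rw [h, zero_add] at h1
  obtain ⟨r, hr, h2⟩ := h1
  have : r = √2 := hN.eq_of_le h𝒩 h2.le
  exact irrational_sqrt_two (this ▸ hS hr)

theorem irrationalNet_not_isStable (hN : IsRealParametrization 𝒩 N) (h𝒩 : IsContinuousNest 𝒩) :
    ¬ IsStable 𝒩 (irrationalNet N) := by
  intro hs
  obtain ⟨Θ, hΘ⟩ := hN.exists_orderIso_translation h𝒩 (√2)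
  have h := hs Θ (unitFamily N {s : ℝ | Irrational s}) rfl
  have h1 := hN.translate_mem hΘ (S := {s : ℝ | Irrational s}) (s := -√2) irrational_sqrt_two.neg
  rw [mem_singleton_iff.1 h, neg_add_cancel] at h1
  obtain ⟨r, hr, h2⟩ := h1
  have : r = 0 := hN.eq_of_le h𝒩 h2.le
  exact not_irrational_zero (this ▸ hr)

theorem continuous_compression (hN : IsRealParametrization 𝒩 N) (h𝒩 : IsContinuousNest 𝒩)
    (X : H →L[ℂ] H) (x : H) :
    Continuous fun s => ((N (s + 1) - N s) * X * (N (s + 1) - N s)) x := by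
  have hE : ∀ x, Continuous fun s => (N (s + 1) - N s) x := fun x =>
    ((hN.continuous x).comp (continuous_add_const 1)).sub (hN.continuous x)
  exact continuous_apply_of_norm_le_one (A := fun s => N (s + 1) - N s)
    (fun s => IsStarProjection.norm_le _ ((hN.isInterval s).isStarProjection h𝒩)) hE
    (X.continuous.comp (hE x))

theorem netIdeal_irrationalNet_subset [TopologicalSpace.SeparableSpace H]
    (hN : IsRealParametrization 𝒩 N) (h𝒩 : IsContinuousNest 𝒩) :
    netIdeal 𝒩 (irrationalNet N) ⊆ netIdeal 𝒩 (rationalNet N) := by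
  rintro X ⟨hX, hlim⟩
  refine ⟨hX, fun ε hε => ?_⟩
  have hirr : ∀ s, Irrational s →
      essNorm ((N (s + 1) - N s) * X * (N (s + 1) - N s)) < ε / 2 := by
    intro s hs
    obtain ⟨P, hP, h⟩ := hlim (ε / 2) (half_pos hε)
    have h1 := h P hP (refines_refl P)
    have hmem : N (s + 1) - N s ∈ P := by
      rw [mem_singleton_iff.1 hP]
      exact ⟨s, hs, rfl⟩
    exact (essNorm_le_supEssNorm (hN.irrationalNet_isNet.isStarProjection h𝒩 hP) X hmem).trans_lt
      ((le_abs_self _).trans_lt h1)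
  let S : Set ℝ := {s | s ∈ range ((↑) : ℚ → ℝ) ∧
    essNorm ((N (s + 1) - N s) * X * (N (s + 1) - N s)) < ε / 2}
  have hmem : unitFamily N S ∈ rationalNet N := by
    refine ⟨S, fun s hs => hs.1, ?_, rfl⟩
    have : range ((↑) : ℚ → ℝ) \ S =
        {s | ε / 2 ≤ essNorm ((N (s + 1) - N s) * X * (N (s + 1) - N s))} := by
      ext s
      constructor
      · rintro ⟨h1, h2⟩
        exact not_lt.1 fun h => h2 ⟨h1, h⟩
      · intro h
        have h : ε / 2 ≤ essNorm ((N (s + 1) - N s) * X * (N (s + 1) - N s)) := h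
        exact ⟨not_not.1 fun h1 => absurd (hirr s h1) (not_lt.2 h), fun h2 => absurd h2.2 (not_lt.2 h)⟩
    rw [this]
    exact isGδ_le_essNorm (hN.continuous_compression h𝒩 X) _
  refine ⟨_, hmem, fun P hP href => ?_⟩
  rw [abs_of_nonneg (supEssNorm_nonneg _ _)]
  refine (href.supEssNorm_le (hN.rationalNet_isNet.isStarProjection h𝒩 hP)
    (hN.rationalNet_isNet.isStarProjection h𝒩 hmem) X).trans_lt
    (lt_of_le_of_lt (supEssNorm_le (half_pos hε).le ?_) (half_lt_self hε))
  rintro _ ⟨s, hs, rfl⟩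
  exact hs.2.le

theorem not_isGδ_range_ratCast : ¬ IsGδ (range ((↑) : ℚ → ℝ)) := by
  intro h
  have h1 : Dense (range ((↑) : ℚ → ℝ) ∩ {x : ℝ | Irrational x}) :=
    Dense.inter_of_Gδ h IsGδ.setOfPred_irrational Rat.denseRange_cast dense_irrational
  obtain ⟨x, hx, hx'⟩ := h1.nonempty
  exact hx' hx

theorem rationalNet_not_isCofinalIn (hN : IsRealParametrization 𝒩 N) (h𝒩 : IsContinuousNest 𝒩) :
    ¬ IsCofinalIn (rationalNet N) (irrationalNet N) := by
  intro h
  obtain ⟨_, ⟨S, hS, hG, rfl⟩, href⟩ := h _ rfl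
  -- By the Baire category theorem `S` is not empty.
  obtain ⟨s, hs⟩ : S.Nonempty := by
    rw [nonempty_iff_ne_empty]
    rintro rfl
    rw [sdiff_empty] at hG
    exact not_isGδ_range_ratCast hG
  obtain ⟨_, ⟨r, hr, rfl⟩, hle⟩ := href _ ⟨s, hs, rfl⟩
  have hr : Irrational r := hr
  rw [← hN.eq_of_le h𝒩 hle] at hr
  exact hr (hS hs)

theorem irrationalNet_not_isCofinalIn (hN : IsRealParametrization 𝒩 N)
    (h𝒩 : IsContinuousNest 𝒩) : ¬ IsCofinalIn (irrationalNet N) (rationalNet N) := by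
  intro h
  obtain ⟨_, rfl, href⟩ := h _ univ_mem_rationalNet
  obtain ⟨_, ⟨r, hr, rfl⟩, hle⟩ := href _ ⟨√2, irrational_sqrt_two, rfl⟩
  rw [← hN.eq_of_le h𝒩 hle] at hr
  exact irrational_sqrt_two hr

end IsRealParametrization

end UnitIntervals

end NestAlgebra

end

open NestAlgebra in
theorem mainTheorem2 {H : Type*} [NormedAddCommGroup H] [InnerProductSpace ℂ H]
    [CompleteSpace H] [TopologicalSpace.SeparableSpace H]
    (𝒩 : Set (H →L[ℂ] H)) (h𝒩 : IsContinuousNest 𝒩) :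
    -- the characterization for stable nets
    (∀ O₁ O₂ : Set (Set (H →L[ℂ] H)),
      IsNet 𝒩 O₁ → IsStable 𝒩 O₁ → IsNet 𝒩 O₂ → IsStable 𝒩 O₂ →
      (∀ Q ∈ O₂, Q.Nonempty) →
      (netIdeal 𝒩 O₁ ⊇ netIdeal 𝒩 O₂ ↔ IsCofinalIn O₁ O₂)) ∧
    -- the example of nets that are not stable
    (Nontrivial H → ∃ N : ℝ → (H →L[ℂ] H), IsRealParametrization 𝒩 N) ∧
    (∀ N : ℝ → (H →L[ℂ] H), IsRealParametrization 𝒩 N →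
      IsNet 𝒩 (rationalNet N) ∧ IsNet 𝒩 (irrationalNet N) ∧
      ¬ IsStable 𝒩 (rationalNet N) ∧ ¬ IsStable 𝒩 (irrationalNet N) ∧
      netIdeal 𝒩 (rationalNet N) ⊇ netIdeal 𝒩 (irrationalNet N) ∧
      ¬ IsCofinalIn (rationalNet N) (irrationalNet N) ∧
      ¬ IsCofinalIn (irrationalNet N) (rationalNet N)) := by
  refine ⟨fun O₁ O₂ h₁ _ h₂ hs₂ hne => ⟨fun hsub => ?_, netIdeal_subset_of_isCofinalIn h𝒩 h₁ h₂⟩,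
    fun _ => ?_, fun N hN => ⟨hN.rationalNet_isNet, hN.irrationalNet_isNet,
      hN.rationalNet_not_isStable h𝒩, hN.irrationalNet_not_isStable h𝒩,
      hN.netIdeal_irrationalNet_subset h𝒩, hN.rationalNet_not_isCofinalIn h𝒩,
      hN.irrationalNet_not_isCofinalIn h𝒩⟩⟩
  · rcases subsingleton_or_nontrivial H with hH | hH
    · -- On the zero space all operators coincide, so every family refines a nonempty one.
      intro Q hQ
      obtain ⟨P, hP⟩ := h₁.nonempty
      obtain ⟨G, hG⟩ := hne Q hQ
      exact ⟨P, hP, fun E _ => ⟨G, hG, (Subsingleton.elim E G).le⟩⟩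
    · obtain ⟨F, hF⟩ := h𝒩.exists_unitParametrization
      exact isCofinalIn_of_netIdeal_subset h𝒩 hF h₁ h₂ hs₂ hne hsub
  · obtain ⟨F, hF⟩ := h𝒩.exists_unitParametrization
    exact hF.isRealParametrization h𝒩
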